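/- Let $h\in(0,1)$, $Y=(0,1)$, $Y_0=(0,h)$, $Y_1=(h,1)$. Let $a_0$ be a real function on $Y_0$, $a_1$ a real function on $Y_1$ and $\rho$ a real function on $Y$, all measurable and positive almost everywhere, with $a_0,a_0^{-1}\in L^\infty(Y_0)$, $a_1,a_1^{-1}\in L^\infty(Y_1)$ and $\rho,\rho^{-1}\in L^\infty(Y)$; extend $a_0$ and $a_1$ by zero to $Y$. Let $L^2_\rho(Y)$ be the complex space $L^2(Y)$ with the inner product $\int_Y\rho f\overline g$. For $\theta\in[0,2\pi)$ let $H^1_\theta(Y)$ be the space of $u\in H^1(Y)$ of the form $u(y)=e^{\mathrm i\theta y}v(y)$ with $v$ a $1$-periodic $H^1$ function (that is, the continuous representative of $u$ satisfies $u(1)=e^{\mathrm i\theta}u(0)$), let $V_\theta=\{u\in H^1_\theta(Y): u'=0 \text{ a.e. on } Y_1\}$, and let $\overline{V_\theta}$ be the closure of $V_\theta$ in $L^2_\rho(Y)$. For $\varepsilon\in(0,1)$ let $A^\varepsilon_\theta$ be the operator in $L^2_\rho(Y)$ associated with the form $\int_Y(a_0+\varepsilon^{-2}a_1)u'\overline{v'}$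 on $H^1_\theta(Y)$: $A^\varepsilon_\theta u=f$ means that $u\in H^1_\theta(Y)$, $f\in L^2_\rho(Y)$ and $\int_Y(a_0+\varepsilon^{-2}a_1)u'\overline{v'}=\int_Y\rho f\overline v$ for all $v\in H^1_\theta(Y)$. Let $A_\theta$ be the operator in $\overline{V_\theta}$ associated with the form $\int_{Y_0}a_0u'\overline{v'}$ on $V_\theta$: $A_\theta u=f$ means that $u\in V_\theta$, $f\in\overline{V_\theta}$ and $\int_{Y_0}a_0u'\overline{v'}=\int_Y\rho f\overline v$ for all $v\in V_\theta$. For $f\in L^2_\rho(Y)$ write $(A_\theta+1)^{-1}f$ for $(A_\theta+1)^{-1}Pf$, where $P$ is the orthogonal projection of $L^2_\rho(Y)$ onto $\overline{V_\theta}$. Then $A^\varepsilon_\theta+1$ and $A_\theta+1$ have bounded inverses on $L^2_\rho(Y)$ and on $\overline{V_\theta}$ respectively, and there is a constant $C>0$, independent of $\varepsilon$, $\theta$ and $f$, such that $$\bigl\|(A^\varepsilon_\theta+1)^{-1}f-(A_\theta+1)^{-1}f\bigr\|_{L^2_\rho(Y)}\le C\varepsilon^2\|f\|_{L^2_\rho(Y)}\qquad\text{for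 all }\varepsilon\in(0,1),\ \theta\in[0,2\pi),\ f\in L^2_\rho(Y).$$ Moreover, for every $\varepsilon\in(0,1)$ and $\theta\in[0,2\pi)$ all eigenvalues of $A^\varepsilon_\theta$ and of $A_\theta$ are real and of finite multiplicity, and they can be listed in infinite non-decreasing sequences $(\lambda^\varepsilon_n(\theta))_{n\in\mathbb N}$ and $(\lambda_n(\theta))_{n\in\mathbb N}$ respectively, each eigenvalue being repeated according to its multiplicity; and for each $n\in\mathbb N$ there is a constant $c_n>0$, independent of $\varepsilon$ and $\theta$, such that $$|\lambda^\varepsilon_n(\theta)-\lambda_n(\theta)|\le c_n\varepsilon^2\qquad\text{for all }\varepsilon\in(0,1),\ \theta\in[0,2\pi).$$ -/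

import Mathlib

open MeasureTheory Set
open scoped ENNReal ContDiff ComplexConjugate

noncomputable section

/-- `w > 0` almost everywhere on `S` and `w, w⁻¹ ∈ L^∞(S)`. -/
def IsAdmissibleWeight (S : Set ℝ) (w : ℝ → ℝ) : Prop :=
  MemLp w ∞ (volume.restrict S) ∧ MemLp (fun y => (w y)⁻¹) ∞ (volume.restrict S) ∧
    ∀ᵐ y ∂(volume.restrict S), 0 < w y

/-- The data on the unit cell `Y = (0,1)`, split into `Y₀ = (0,h)` and `Y₁ = (h,1)`:
the coefficients `a₀` on `Y₀` and `a₁` on `Y₁`, and the density `ρ` on `Y`.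
The values of `a₀` outside `Y₀`, of `a₁` outside `Y₁` and of `ρ` outside `Y` are never used. -/
structure PeriodicCell where
  h : ℝ
  h_pos : 0 < h
  h_lt_one : h < 1
  a₀ : ℝ → ℝ
  a₁ : ℝ → ℝ
  ρ : ℝ → ℝ
  a₀_adm : IsAdmissibleWeight (Ioo 0 h) a₀
  a₁_adm : IsAdmissibleWeight (Ioo h 1) a₁
  ρ_adm : IsAdmissibleWeight (Ioo 0 1) ρ

/-- Lebesgue measure on the unit cell `Y = (0,1)`. -/
abbrev cellMeasure : Measure ℝ := volume.restrict (Ioo (0 : ℝ) 1)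

/-- `g` is the weak derivative of `u` on `Y = (0,1)`. -/
def HasWeakDerivOnCell (u g : ℝ → ℂ) : Prop :=
  ∀ φ : ℝ → ℝ, ContDiff ℝ ∞ φ → HasCompactSupport φ → tsupport φ ⊆ Ioo 0 1 →
    ∫ y in Ioo (0 : ℝ) 1, deriv φ y • u y = - ∫ y in Ioo (0 : ℝ) 1, φ y • g y

/-- `u(y) = exp(iθy) v(y)` on `Y` for a continuous `1`-periodic function `v`. For `u ∈ H¹(Y)` such
a `v` is automatically in `H¹(Y)`; continuity together with periodicity expresses that the `H¹`
function `v` on `Y` takes the same value at the two end points, i.e. is `1`-periodic as an `H¹`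
function. -/
def IsQuasiperiodic (θ : ℝ) (u : ℝ → ℂ) : Prop :=
  ∃ v : ℝ → ℂ, Continuous v ∧ Function.Periodic v 1 ∧
    ∀ᵐ y ∂cellMeasure, u y = Complex.exp (Complex.I * θ * y) * v y

/-- The space `L²(Y)` (unweighted), in which the weak derivatives live. -/
abbrev L2Cell : Type := Lp ℂ 2 cellMeasure

lemma IsAdmissibleWeight.integrable_mul {w : ℝ → ℝ}
    (hw : MemLp w ∞ cellMeasure) (g k : L2Cell) :
    Integrable (fun y => (w y : ℂ) * g y * conj (k y)) cellMeasure := by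
  have h1 : MemLp (fun y => (w y : ℂ)) ∞ cellMeasure := hw.ofReal
  have h2 : MemLp (fun y => (w y : ℂ) * g y) 2 cellMeasure := (Lp.memLp g).mul h1
  have h3 : MemLp (fun y => conj (k y)) 2 cellMeasure := (Lp.memLp k).star
  exact h2.integrable_mul h3

lemma integral_form_add {w : ℝ → ℝ} (hw : MemLp w ∞ cellMeasure) (g₁ g₂ k : L2Cell) :
    ∫ y in Ioo (0 : ℝ) 1, (w y : ℂ) * (g₁ + g₂ : L2Cell) y * conj (k y) =
      (∫ y in Ioo (0 : ℝ) 1, (w y : ℂ) * g₁ y * conj (k y)) +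
        ∫ y in Ioo (0 : ℝ) 1, (w y : ℂ) * g₂ y * conj (k y) := by
  rw [← integral_add (IsAdmissibleWeight.integrable_mul hw g₁ k)
    (IsAdmissibleWeight.integrable_mul hw g₂ k)]
  refine integral_congr_ae ?_
  filter_upwards [Lp.coeFn_add g₁ g₂] with y hy
  rw [hy, Pi.add_apply]
  ring

lemma integral_form_smul {w : ℝ → ℝ} (c : ℂ) (g k : L2Cell) :
    ∫ y in Ioo (0 : ℝ) 1, (w y : ℂ) * (c • g : L2Cell) y * conj (k y) =
      c * ∫ y in Ioo (0 : ℝ) 1, (w y : ℂ) * g y * conj (k y) := by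
  rw [← integral_const_mul]
  refine integral_congr_ae ?_
  filter_upwards [Lp.coeFn_smul c g] with y hy
  rw [hy, Pi.smul_apply, smul_eq_mul]
  ring

namespace PeriodicCell

variable (M : PeriodicCell)

/-- The measure `ρ dy` on `Y`. -/
def weightedMeasure : Measure ℝ :=
  cellMeasure.withDensity (fun y => ENNReal.ofReal (M.ρ y))

/-- The Hilbert space `L²_ρ(Y)`: its inner product is
`inner ℂ v f = ∫_Y ρ f conj(v)` and its norm is `‖f‖² = ∫_Y ρ |f|²`. -/
abbrev L2 : Type := Lp ℂ 2 M.weightedMeasure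

/-- The coefficient `a₀ + ε⁻² a₁` on `Y`, where `a₀` is extended by zero to `Y₁` and `a₁` is
extended by zero to `Y₀`. -/
def coeff (ε : ℝ) : ℝ → ℝ := fun y =>
  (Ioo 0 M.h).indicator M.a₀ y + (ε ^ 2)⁻¹ * (Ioo M.h 1).indicator M.a₁ y

/-- The degenerate coefficient `a₀`, extended by zero to `Y₁`. -/
def softCoeff : ℝ → ℝ := (Ioo 0 M.h).indicator M.a₀

lemma memLp_softCoeff : MemLp M.softCoeff ∞ cellMeasure :=
  ((memLp_indicator_iff_restrict measurableSet_Ioo).2 M.a₀_adm.1).restrict _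

lemma memLp_coeff (ε : ℝ) : MemLp (M.coeff ε) ∞ cellMeasure :=
  M.memLp_softCoeff.add
    ((((memLp_indicator_iff_restrict measurableSet_Ioo).2 M.a₁_adm.1).restrict _).const_mul _)

lemma aemeasurable_rho : AEMeasurable (fun y => ENNReal.ofReal (M.ρ y)) cellMeasure :=
  M.ρ_adm.1.1.aemeasurable.ennreal_ofReal

lemma cellMeasure_absolutelyContinuous : cellMeasure ≪ M.weightedMeasure := by
  refine withDensity_absolutelyContinuous' M.aemeasurable_rho ?_
  filter_upwards [M.ρ_adm.2.2] with y hy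
  simpa using hy

lemma cellMeasure_le : ∃ c : ℝ≥0∞, c ≠ ⊤ ∧ cellMeasure ≤ c • M.weightedMeasure := by
  refine ⟨eLpNorm (fun y => (M.ρ y)⁻¹) ⊤ cellMeasure, M.ρ_adm.2.1.2.ne, ?_⟩
  set c := eLpNorm (fun y => (M.ρ y)⁻¹) ⊤ cellMeasure with hc
  have hle : ∀ᵐ y ∂cellMeasure, (1 : ℝ≥0∞) ≤ c * ENNReal.ofReal (M.ρ y) := by
    have := ae_le_eLpNormEssSup (f := fun y => (M.ρ y)⁻¹) (μ := cellMeasure)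
    rw [← eLpNorm_exponent_top] at this
    filter_upwards [this, M.ρ_adm.2.2] with y hy hpos
    calc (1 : ℝ≥0∞) = ENNReal.ofReal ((M.ρ y)⁻¹) * ENNReal.ofReal (M.ρ y) := by
          rw [← ENNReal.ofReal_mul (by positivity), inv_mul_cancel₀ hpos.ne', ENNReal.ofReal_one]
      _ ≤ c * ENNReal.ofReal (M.ρ y) := by
          gcongr
          rwa [Real.enorm_of_nonneg (by positivity)] at hy
  calc cellMeasure = cellMeasure.withDensity 1 := withDensity_one.symm
    _ ≤ cellMeasure.withDensity (c • fun y => ENNReal.ofReal (M.ρ y)) := withDensity_mono hle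
    _ = c • M.weightedMeasure := withDensity_smul' _ _ M.ρ_adm.2.1.2.ne

lemma memLp_cell (u : M.L2) : MemLp u 2 cellMeasure := by
  obtain ⟨c, hc, hle⟩ := M.cellMeasure_le
  exact (Lp.memLp u).of_measure_le_smul hc hle

/-- The space `H¹_θ(Y)` of `θ`-quasiperiodic functions `u ∈ H¹(Y)`. An element is recorded as the
pair `(u, u')` of the function `u ∈ L²_ρ(Y) = L²(Y)` and its weak derivative `u' ∈ L²(Y)`. -/
def H1theta (θ : ℝ) : Submodule ℂ (M.L2 × L2Cell) where
  carrier := {p | HasWeakDerivOnCell p.1 p.2 ∧ IsQuasiperiodic θ p.1}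
  zero_mem' := by
    have h1 : ((0 : M.L2) : ℝ → ℂ) =ᵐ[cellMeasure] 0 :=
      M.cellMeasure_absolutelyContinuous.ae_le (Lp.coeFn_zero ℂ 2 M.weightedMeasure)
    have h2 : ((0 : L2Cell) : ℝ → ℂ) =ᵐ[cellMeasure] 0 := Lp.coeFn_zero ℂ 2 cellMeasure
    refine ⟨fun φ _ _ _ => ?_, 0, continuous_zero, fun _ => rfl, ?_⟩
    · rw [integral_eq_zero_of_ae, integral_eq_zero_of_ae, neg_zero]
      · filter_upwards [h2] with y hy
        simp_all
      · filter_upwards [h1] with y hy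
        simp_all
    · filter_upwards [h1] with y hy
      simpa using hy
  add_mem' := by
    rintro ⟨u, g⟩ ⟨v, k⟩ ⟨hu, U, hUc, hUp, hU⟩ ⟨hv, V, hVc, hVp, hV⟩
    have h1 : ((u + v : M.L2) : ℝ → ℂ) =ᵐ[cellMeasure] u + v :=
      M.cellMeasure_absolutelyContinuous.ae_le (Lp.coeFn_add u v)
    have h2 : ((g + k : L2Cell) : ℝ → ℂ) =ᵐ[cellMeasure] g + k := Lp.coeFn_add g k
    refine ⟨fun φ hφ hc hs => ?_, U + V, hUc.add hVc, hUp.add hVp, ?_⟩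
    · have hφ2 : MemLp φ 2 cellMeasure :=
        (hφ.continuous.memLp_of_hasCompactSupport hc).restrict _
      have hφ2' : MemLp (deriv φ) 2 cellMeasure :=
        ((hφ.continuous_deriv (by simp)).memLp_of_hasCompactSupport hc.deriv).restrict _
      have e1 : ∫ y in Ioo (0 : ℝ) 1, deriv φ y • (u + v : M.L2) y =
          (∫ y in Ioo (0 : ℝ) 1, deriv φ y • u y) + ∫ y in Ioo (0 : ℝ) 1, deriv φ y • v y := by
        have i1 : Integrable (fun y => deriv φ y • u y) cellMeasure :=
          memLp_one_iff_integrable.1 ((M.memLp_cell u).smul hφ2')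
        have i2 : Integrable (fun y => deriv φ y • v y) cellMeasure :=
          memLp_one_iff_integrable.1 ((M.memLp_cell v).smul hφ2')
        rw [← integral_add i1 i2]
        refine integral_congr_ae ?_
        filter_upwards [h1] with y hy
        rw [hy, Pi.add_apply, smul_add]
      have e2 : ∫ y in Ioo (0 : ℝ) 1, φ y • (g + k : L2Cell) y =
          (∫ y in Ioo (0 : ℝ) 1, φ y • g y) + ∫ y in Ioo (0 : ℝ) 1, φ y • k y := by
        have i1 : Integrable (fun y => φ y • g y) cellMeasure :=
          memLp_one_iff_integrable.1 ((Lp.memLp g).smul hφ2)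
        have i2 : Integrable (fun y => φ y • k y) cellMeasure :=
          memLp_one_iff_integrable.1 ((Lp.memLp k).smul hφ2)
        rw [← integral_add i1 i2]
        refine integral_congr_ae ?_
        filter_upwards [h2] with y hy
        rw [hy, Pi.add_apply, smul_add]
      have e3 := hu φ hφ hc hs
      have e4 := hv φ hφ hc hs
      dsimp only [Prod.mk_add_mk] at e3 e4 ⊢
      rw [e1, e2, e3, e4, neg_add]
    · filter_upwards [h1, hU, hV] with y hy hyU hyV
      dsimp only [Prod.mk_add_mk] at hyU hyV ⊢
      rw [hy, Pi.add_apply, hyU, hyV, Pi.add_apply, mul_add]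
  smul_mem' := by
    rintro c ⟨u, g⟩ ⟨hu, U, hUc, hUp, hU⟩
    have h1 : ((c • u : M.L2) : ℝ → ℂ) =ᵐ[cellMeasure] c • u :=
      M.cellMeasure_absolutelyContinuous.ae_le (Lp.coeFn_smul c u)
    have h2 : ((c • g : L2Cell) : ℝ → ℂ) =ᵐ[cellMeasure] c • g := Lp.coeFn_smul c g
    refine ⟨fun φ hφ hc hs => ?_, c • U, hUc.const_smul c, hUp.smul c, ?_⟩
    · have e1 : ∫ y in Ioo (0 : ℝ) 1, deriv φ y • (c • u : M.L2) y =
          c • ∫ y in Ioo (0 : ℝ) 1, deriv φ y • u y := by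
        rw [← integral_smul]
        refine integral_congr_ae ?_
        filter_upwards [h1] with y hy
        rw [hy, Pi.smul_apply, smul_comm]
      have e2 : ∫ y in Ioo (0 : ℝ) 1, φ y • (c • g : L2Cell) y =
          c • ∫ y in Ioo (0 : ℝ) 1, φ y • g y := by
        rw [← integral_smul]
        refine integral_congr_ae ?_
        filter_upwards [h2] with y hy
        rw [hy, Pi.smul_apply, smul_comm]
      have e3 := hu φ hφ hc hs
      dsimp only [Prod.smul_mk] at e3 ⊢
      rw [e1, e2, e3, smul_neg]
    · filter_upwards [h1, hU] with y hy hyU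
      dsimp only [Prod.smul_mk] at hyU ⊢
      rw [hy, Pi.smul_apply, hyU, Pi.smul_apply, smul_eq_mul, smul_eq_mul, mul_left_comm]

/-- The space `V_θ` of those `u ∈ H¹_θ(Y)` with `u' = 0` on `Y₁`, again recorded as
pairs `(u, u')`. -/
def Vtheta (θ : ℝ) : Submodule ℂ (M.L2 × L2Cell) where
  carrier := {p | p ∈ M.H1theta θ ∧ ∀ᵐ y ∂cellMeasure, y ∈ Ioo M.h 1 → p.2 y = 0}
  zero_mem' := by
    refine ⟨zero_mem _, ?_⟩
    filter_upwards [Lp.coeFn_zero ℂ 2 cellMeasure] with y hy _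
    exact hy
  add_mem' := by
    rintro p q ⟨hp, hp'⟩ ⟨hq, hq'⟩
    refine ⟨add_mem hp hq, ?_⟩
    filter_upwards [hp', hq', Lp.coeFn_add p.2 q.2] with y h1 h2 h3 hy
    rw [Prod.snd_add, h3, Pi.add_apply, h1 hy, h2 hy, add_zero]
  smul_mem' := by
    rintro c p ⟨hp, hp'⟩
    refine ⟨Submodule.smul_mem _ c hp, ?_⟩
    filter_upwards [hp', Lp.coeFn_smul c p.2] with y h1 h3 hy
    rw [Prod.smul_snd, h3, Pi.smul_apply, h1 hy, smul_zero]

/-- The closure in `L²_ρ(Y)` of the form domain `D` (a space of pairs `(u, u')`). -/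
def formClosure (D : Submodule ℂ (M.L2 × L2Cell)) : Submodule ℂ M.L2 :=
  (D.map (LinearMap.fst ℂ M.L2 L2Cell)).topologicalClosure

/-- The graph of the operator associated with the form `∫_Y w u' conj(v')` on the domain `D`. It
consists of the pairs `(u, f)` such that `u` is in the form domain, `f` is in its closure, and
`∫_Y w u' conj(v') = ∫_Y ρ f conj(v)` for all `v` in the form domain. -/
def formGraph (D : Submodule ℂ (M.L2 × L2Cell)) {w : ℝ → ℝ} (hw : MemLp w ∞ cellMeasure) :
    Submodule ℂ (M.L2 × M.L2) where
  carrier := {p | p.2 ∈ M.formClosure D ∧ ∃ g : L2Cell, (p.1, g) ∈ D ∧ ∀ q ∈ D,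
    ∫ y in Ioo (0 : ℝ) 1, (w y : ℂ) * g y * conj (q.2 y) = inner ℂ q.1 p.2}
  zero_mem' := by
    refine ⟨zero_mem _, 0, zero_mem _, fun q _ => ?_⟩
    have := integral_form_smul (w := w) 0 0 q.2
    rw [zero_smul, zero_mul] at this
    rw [this, Prod.snd_zero, inner_zero_right]
  add_mem' := by
    rintro p₁ p₂ ⟨hp₁, g₁, hg₁, h₁⟩ ⟨hp₂, g₂, hg₂, h₂⟩
    refine ⟨add_mem hp₁ hp₂, g₁ + g₂, add_mem hg₁ hg₂, fun q hq => ?_⟩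
    rw [integral_form_add hw, h₁ q hq, h₂ q hq, Prod.snd_add, inner_add_right]
  smul_mem' := by
    rintro c p ⟨hp, g, hg, h⟩
    refine ⟨Submodule.smul_mem _ c hp, c • g, Submodule.smul_mem _ c hg, fun q hq => ?_⟩
    rw [integral_form_smul, h q hq, Prod.smul_snd, inner_smul_right]

/-- The operator associated with the form `∫_Y w u' conj(v')` on the domain `D`, as a partially
defined linear operator acting in the closure of `D`. -/
def formOperator (D : Submodule ℂ (M.L2 × L2Cell)) {w : ℝ → ℝ} (hw : MemLp w ∞ cellMeasure) :
    M.L2 →ₗ.[ℂ] M.L2 :=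
  (M.formGraph D hw).toLinearPMap

/-- The operator `A^ε_θ` in `L²_ρ(Y)` associated with the form
`β^ε_θ(u,v) = ∫_Y (a₀ + ε⁻² a₁) u' conj(v')` on `H¹_θ(Y)`. -/
def fibreOperator (ε θ : ℝ) : M.L2 →ₗ.[ℂ] M.L2 :=
  M.formOperator (M.H1theta θ) (M.memLp_coeff ε)

/-- The closure of `V_θ` in `L²_ρ(Y)`. -/
abbrev Vclosure (θ : ℝ) : Submodule ℂ M.L2 := M.formClosure (M.Vtheta θ)

/-- The limit operator `A_θ`, acting in the closure of `V_θ` and associated with the form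
`∫_{Y₀} a₀ u' conj(v')` on `V_θ`. -/
def limitOperator (θ : ℝ) : M.L2 →ₗ.[ℂ] M.L2 :=
  M.formOperator (M.Vtheta θ) M.memLp_softCoeff

/-- The operator associated with a form on `D` is single valued: for each `u` there is at most one
`f`. -/
lemma formGraph_single_valued (D : Submodule ℂ (M.L2 × L2Cell)) {w : ℝ → ℝ}
    (hw : MemLp w ∞ cellMeasure)
    (hD : ∀ p ∈ D, HasWeakDerivOnCell p.1 p.2) :
    ∀ x ∈ M.formGraph D hw, x.1 = 0 → x.2 = 0 := by
  rintro ⟨u, f⟩ ⟨hf, g, hg, h⟩ (rfl : u = 0)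
  -- the weak derivative of zero vanishes
  have h0 : ((0 : M.L2) : ℝ → ℂ) =ᵐ[cellMeasure] 0 :=
    M.cellMeasure_absolutelyContinuous.ae_le (Lp.coeFn_zero ℂ 2 M.weightedMeasure)
  have hg0 : ∀ᵐ y ∂volume, y ∈ Ioo (0 : ℝ) 1 → g y = 0 := by
    refine isOpen_Ioo.ae_eq_zero_of_integral_contDiff_smul_eq_zero ?_ ?_
    · have : IntegrableOn g (Ioo 0 1) volume := (Lp.memLp g).integrable one_le_two
      exact this.locallyIntegrableOn
    · intro φ hφ hc hs
      have e := hD _ hg φ hφ hc hs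
      have z : ∫ y in Ioo (0 : ℝ) 1, deriv φ y • (0 : M.L2) y = 0 := by
        refine integral_eq_zero_of_ae ?_
        filter_upwards [h0] with y hy
        rw [hy]; simp
      dsimp only at e
      rw [z, zero_eq_neg] at e
      rw [← e]
      refine (setIntegral_eq_integral_of_forall_compl_eq_zero fun y hy => ?_).symm
      rw [image_eq_zero_of_notMem_tsupport fun hy' => hy (hs hy'), zero_smul]
  have hg1 : (g : ℝ → ℂ) =ᵐ[cellMeasure] 0 := (ae_restrict_iff' measurableSet_Ioo).2 hg0
  -- hence `f` is orthogonal to the form domain, while lying in its closure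
  have horth : f ∈ (D.map (LinearMap.fst ℂ M.L2 L2Cell))ᗮ := by
    rw [Submodule.mem_orthogonal]
    rintro _ ⟨q, hq, rfl⟩
    refine (h q hq).symm.trans (integral_eq_zero_of_ae ?_)
    filter_upwards [hg1] with y hy
    rw [hy]; simp
  have hf' : f ∈ (D.map (LinearMap.fst ℂ M.L2 L2Cell)).topologicalClosure := hf
  rw [← Submodule.orthogonal_closure] at horth
  exact inner_self_eq_zero.1 ((Submodule.mem_orthogonal _ _).1 horth f hf')

lemma fibreOperator_graph (ε θ : ℝ) :
    (M.fibreOperator ε θ).graph = M.formGraph (M.H1theta θ) (M.memLp_coeff ε) :=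
  Submodule.toLinearPMap_graph_eq _
    (M.formGraph_single_valued _ _ fun _ hp => hp.1)

lemma limitOperator_graph (θ : ℝ) :
    (M.limitOperator θ).graph = M.formGraph (M.Vtheta θ) M.memLp_softCoeff :=
  Submodule.toLinearPMap_graph_eq _
    (M.formGraph_single_valued _ _ fun _ hp => hp.1.1)

end PeriodicCell

section Abstract

variable {H : Type*} [NormedAddCommGroup H] [InnerProductSpace ℂ H]

/-- `R` is the resolvent `(A + 1)⁻¹` of an operator `A` acting in the closed subspace `K` of `H`,
as a bounded operator on `H`: on `K` it is a two-sided inverse of `A + 1`, and it is extended to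
`H` by zero on `Kᗮ`, i.e. `R f = (A + 1)⁻¹ P f` with `P` the orthogonal projection onto `K`. -/
structure IsResolventAddOne (A : H →ₗ.[ℂ] H) (K : Submodule ℂ H) (R : H →L[ℂ] H) : Prop where
  right_inv : ∀ f ∈ K, ∃ hf : R f ∈ A.domain, A ⟨R f, hf⟩ + R f = f
  left_inv : ∀ u : A.domain, R (A u + u) = u
  eq_zero : ∀ f ∈ Kᗮ, R f = 0

/-- The eigenspace `{u ∈ dom A | A u = μ u}`. -/
def pmapEigenspace (A : H →ₗ.[ℂ] H) (μ : ℂ) : Submodule ℂ H :=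
  A.graph.comap (LinearMap.id.prod (μ • LinearMap.id))

/-- `ev` lists all the eigenvalues of `A` in increasing order, counted with multiplicity: all
eigenvalues are real, have finite multiplicity, and each is repeated as many times as its
multiplicity. -/
structure IsEigenvalueSequence (A : H →ₗ.[ℂ] H) (ev : ℕ → ℝ) : Prop where
  monotone : Monotone ev
  finite_mult : ∀ μ : ℂ, FiniteDimensional ℂ (pmapEigenspace A μ)
  finite_fibre : ∀ μ : ℂ, {n | (ev n : ℂ) = μ}.Finite
  mult : ∀ μ : ℂ, {n | (ev n : ℂ) = μ}.ncard = Module.finrank ℂ (pmapEigenspace A μ)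

end Abstract

end

/-! A function is handled as a pair `(u, u')` in a closed subspace of `L²_ρ × L²`, and each form is
`⟪S g, S k⟫` with `S` multiplication by the square root of the coefficient. Resolvents are then
orthogonal projections (`exists_isFormSolution`), and `H¹_θ` is described by one constant and one
derivative: `u = c + ∫₀ʸ u'` with `c + ∫ u' = exp(iθ) c` (`mem_H1theta_iff`).

Resolvent estimate (`IsFormSolution.norm_sub_le`). On `V_θ` the two forms agree, so the difference
`w` of the two solutions is energy-orthogonal to `V_θ`. This has two consequences. The energy of `w`
is at most `‖w‖ ‖f‖`. Moreover, `‖w‖` is at most the distance of `w` from `V_θ` in the energy norm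
of the fixed parameter `ε = 1`. That distance is controlled by `w'` on `Y₁`: subtracting the
primitive of `w'` restricted to `Y₁`, corrected on `Y₀` to have mean zero, leaves an element of
`V_θ`. Since the coefficient on `Y₁` is `ε⁻² a₁`, the norm of `w'` there is at most `B ε` times the
square root of the energy. Hence `‖w‖² ≤ c ε² ‖w‖ ‖f‖`. The correction vanishes at both ends of the
cell, so no constant depends on `θ`.

Eigenvalues. The resolvents are compact because the primitive is (Arzelà–Ascoli), and min-max turns
the estimate into a bound on `(1 + λₙ)⁻¹` (`inv_sub_le`). To return to `λₙ` one needs these numbers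
bounded below uniformly in `ε` and `θ`. Primitives of mean-free functions supported in `Y₀` supply
this: they belong to every `V_θ`, and their energy does not involve `ε` (`exists_testSpace`). -/

noncomputable section

/-! ### Enumeration of a discrete family in non-decreasing order. -/

/-- An infinite linear order with finite lower sections is isomorphic to `ℕ`. -/
lemma nonempty_orderIso_nat_of_finite_Iic {α : Type*} [LinearOrder α] [Infinite α]
    (h : ∀ a : α, (Set.Iic a).Finite) : Nonempty (ℕ ≃o α) := by
  classical
  let : LocallyFiniteOrder α :=
    LocallyFiniteOrder.ofFiniteIcc fun a b => (h b).subset fun x hx => hx.2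
  obtain ⟨a⟩ : Nonempty α := inferInstance
  obtain ⟨m, hm, hmin⟩ := Set.exists_min_image (Set.Iic a) id (h a) ⟨a, le_refl a⟩
  let : OrderBot α :=
    { bot := m
      bot_le := fun x => by
        rcases le_total x a with hx | hx
        · exact hmin x hx
        · exact (show m ≤ a from hm).trans hx }
  have : NoMaxOrder α := by
    refine ⟨fun b => ?_⟩
    by_contra! hb
    exact Set.infinite_univ ((h b).subset fun x _ => hb x)
  let : SuccOrder α := LinearLocallyFiniteOrder.succOrder α
  let : PredOrder α := LinearLocallyFiniteOrder.predOrder α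
  exact ⟨orderIsoNatOfLinearSuccPredArch.symm⟩

/-- A real function with finite sublevel sets on an infinite type can be enumerated in
non-decreasing order. -/
lemma exists_equiv_nat_monotone {ι : Type*} [Infinite ι] (f : ι → ℝ)
    (hf : ∀ c, {i | f i ≤ c}.Finite) : ∃ σ : ℕ ≃ ι, Monotone fun n => f (σ n) := by
  classical
  -- Ties of `f` are broken by an arbitrary well-order, so that the lexicographic order is linear
  -- and its lower sections sit inside sublevel sets of `f`.
  let : LinearOrder ι := IsWellOrder.linearOrder (WellOrderingRel (α := ι))
  let g : ι → ℝ ×ₗ ι := fun i => toLex (f i, i)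
  have hg : Function.Injective g := fun i j hij => congrArg (fun p => (ofLex p).2) hij
  let e : ι ≃ Set.range g := Equiv.ofInjective g hg
  have : Infinite (Set.range g) := Infinite.of_injective e e.injective
  have hle : ∀ i j, g i ≤ g j → f i ≤ f j := by
    intro i j hij
    rcases Prod.Lex.toLex_le_toLex.1 hij with h | h
    · exact h.le
    · exact h.1.le
  have hfin : ∀ a : Set.range g, (Set.Iic a).Finite := by
    rintro ⟨_, j, rfl⟩
    refine ((hf (f j)).image e).subset ?_
    rintro ⟨_, i, rfl⟩ hx
    exact ⟨i, hle i j hx, rfl⟩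
  obtain ⟨o⟩ := nonempty_orderIso_nat_of_finite_Iic hfin
  refine ⟨o.toEquiv.trans e.symm, fun m n hmn => hle _ _ ?_⟩
  have key : ∀ n, g (e.symm (o n)) = (o n : ℝ ×ₗ ι) := fun n =>
    congrArg Subtype.val (e.apply_symm_apply (o n))
  change g (e.symm (o m)) ≤ g (e.symm (o n))
  rw [key, key]
  exact o.monotone hmn

/-! ### Spectral theory and min-max for operators with compact resolvent. -/

section Spectral

variable {H : Type*} [NormedAddCommGroup H] [InnerProductSpace ℂ H]

/-- `R` is the compact, symmetric and positive resolvent `(A + 1)⁻¹` of an operator `A` acting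
in `K`. -/
structure IsCompactResolvent (A : H →ₗ.[ℂ] H) (K : Submodule ℂ H) (R : H →L[ℂ] H) : Prop
    extends IsResolventAddOne A K R where
  domain_le : A.domain ≤ K
  compact : IsCompactOperator R
  symm : (R : H →ₗ[ℂ] H).IsSymmetric
  nonneg : ∀ x, 0 ≤ (inner ℂ x (R x)).re

lemma mem_pmapEigenspace_iff_graph {A : H →ₗ.[ℂ] H} {μ : ℂ} {u : H} :
    u ∈ pmapEigenspace A μ ↔ ∃ h : u ∈ A.domain, A ⟨u, h⟩ = μ • u := by
  change (u, μ • u) ∈ A.graph ↔ _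
  rw [LinearPMap.mem_graph_iff]
  constructor
  · rintro ⟨⟨y, hy⟩, h1, h2⟩
    obtain rfl : y = u := h1
    exact ⟨hy, h2⟩
  · rintro ⟨h, h2⟩
    exact ⟨⟨u, h⟩, rfl, h2⟩

/-- In an orthonormal family diagonalizing an operator, the quadratic form is diagonal. -/
lemma Orthonormal.re_inner_sum_apply {ι : Type*} {e : ι → H} (he : Orthonormal ℂ e) {m : ι → ℝ}
    {R : H →L[ℂ] H} (hR : ∀ i, R (e i) = (m i : ℂ) • e i) (s : Finset ι) (c : ι → ℂ) :
    (inner ℂ (∑ i ∈ s, c i • e i) (R (∑ i ∈ s, c i • e i))).re = ∑ i ∈ s, m i * ‖c i‖ ^ 2 ∧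
      ‖∑ i ∈ s, c i • e i‖ ^ 2 = ∑ i ∈ s, ‖c i‖ ^ 2 := by
  have h1 : R (∑ i ∈ s, c i • e i) = ∑ i ∈ s, (c i * m i) • e i := by
    rw [map_sum]
    exact Finset.sum_congr rfl fun i _ => by rw [map_smul, hR, smul_smul]
  constructor
  · rw [h1, he.inner_sum, Complex.re_sum]
    refine Finset.sum_congr rfl fun i _ => ?_
    rw [← mul_assoc, ← Complex.normSq_eq_conj_mul_self, ← Complex.ofReal_mul, Complex.ofReal_re,
      Complex.normSq_eq_norm_sq, mul_comm]
  · rw [← @inner_self_eq_norm_sq ℂ, he.inner_sum]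
    simp only [RCLike.re_to_complex, Complex.re_sum]
    refine Finset.sum_congr rfl fun i _ => ?_
    rw [← Complex.normSq_eq_conj_mul_self, Complex.ofReal_re, Complex.normSq_eq_norm_sq]

/-- A subspace of dimension greater than `n` contains a nonzero vector orthogonal to `n` given
vectors. -/
lemma exists_ne_zero_mem_of_finrank_gt {ι : Type*} [Fintype ι] (W : Submodule ℂ H)
    (hW : Fintype.card ι < Module.finrank ℂ W) (e : ι → H) :
    ∃ x ∈ W, x ≠ 0 ∧ ∀ i, inner ℂ (e i) x = 0 := by
  have : FiniteDimensional ℂ W := FiniteDimensional.of_finrank_pos (by omega)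
  let L : W →ₗ[ℂ] (ι → ℂ) := LinearMap.pi fun i => (innerSL ℂ (e i)).toLinearMap ∘ₗ W.subtype
  have hL : LinearMap.ker L ≠ ⊥ := LinearMap.ker_ne_bot_of_finrank_lt (by simpa using hW)
  obtain ⟨x, hx, hx0⟩ := Submodule.exists_mem_ne_zero_of_ne_bot hL
  exact ⟨x, x.2, by simpa using hx0, fun i => congrFun (LinearMap.mem_ker.1 hx) i⟩

namespace IsCompactResolvent

variable {A : H →ₗ.[ℂ] H} {K : Submodule ℂ H} {R : H →L[ℂ] H}

lemma apply_mem [K.HasOrthogonalProjection] (h : IsCompactResolvent A K R) (f : H) : R f ∈ K := by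
  obtain ⟨g, hg, k, hk, rfl⟩ := K.exists_add_mem_mem_orthogonal f
  rw [map_add, h.eq_zero k hk, add_zero]
  exact h.domain_le (h.right_inv g hg).1

/-- Multiplying by `μ + 1` rather than dividing covers `μ = -1` too, where the right side forces `u
= 0`: `-1` is never an eigenvalue. -/
lemma mem_pmapEigenspace_iff [K.HasOrthogonalProjection] (h : IsCompactResolvent A K R) {μ : ℂ}
    {u : H} : u ∈ pmapEigenspace A μ ↔ (μ + 1) • R u = u := by
  rw [mem_pmapEigenspace_iff_graph]
  constructor
  · rintro ⟨hu, hA⟩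
    have := h.left_inv ⟨u, hu⟩
    rw [hA] at this
    rwa [← map_smul, add_smul, one_smul]
  · intro hu
    have huK : (μ + 1) • u ∈ K := K.smul_mem _ (hu ▸ K.smul_mem _ (h.apply_mem u))
    obtain ⟨hf, hA⟩ := h.right_inv _ huK
    have e : R ((μ + 1) • u) = u := by rw [map_smul, hu]
    simp only [e] at hf hA
    refine ⟨hf, ?_⟩
    exact add_right_cancel (hA.trans (by rw [add_smul, one_smul]))

lemma pmapEigenspace_le [K.HasOrthogonalProjection] (h : IsCompactResolvent A K R) (μ : ℂ) :
    pmapEigenspace A μ ≤ Module.End.eigenspace (R : H →ₗ[ℂ] H) (μ + 1)⁻¹ := by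
  intro u hu
  rw [h.mem_pmapEigenspace_iff] at hu
  rw [Module.End.mem_eigenspace_iff]
  by_cases hμ : μ + 1 = 0
  · rw [hμ, zero_smul] at hu
    simp [← hu]
  · conv_rhs => rw [← hu]
    rw [smul_smul, inv_mul_cancel₀ hμ, one_smul]
    rfl

/-- The eigenvalues are real and greater than `-1`. -/
lemma eigenvalue_real [K.HasOrthogonalProjection] (h : IsCompactResolvent A K R) {μ : ℂ} {u : H}
    (hu : u ∈ pmapEigenspace A μ) (h0 : u ≠ 0) : (μ.re : ℂ) = μ ∧ 0 < 1 + μ.re := by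
  rw [h.mem_pmapEigenspace_iff] at hu
  obtain ⟨r, hr⟩ : ∃ r : ℝ, inner ℂ u (R u) = (r : ℂ) := by
    refine Complex.conj_eq_iff_real.1 ?_
    rw [inner_conj_symm]
    exact h.symm u u
  have hr0 : 0 ≤ r := by simpa [hr] using h.nonneg u
  have e : (μ + 1) * r = ((‖u‖ ^ 2 : ℝ) : ℂ) := by
    rw [← hr, ← inner_smul_right, hu, inner_self_eq_norm_sq_to_K]
    simp
  have hu2 : 0 < ‖u‖ ^ 2 := by positivity
  have e1 := congrArg Complex.re e
  have e2 := congrArg Complex.im e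
  rw [Complex.ofReal_re, Complex.re_mul_ofReal, Complex.add_re, Complex.one_re] at e1
  rw [Complex.ofReal_im, Complex.im_mul_ofReal, Complex.add_im, Complex.one_im, add_zero] at e2
  have hrpos : 0 < r := lt_of_le_of_ne hr0 fun hr => by rw [← hr] at e1; linarith
  constructor
  · apply Complex.ext
    · simp
    · simpa using ((mul_eq_zero.1 e2).resolve_right hrpos.ne').symm
  · by_contra! hc
    nlinarith

lemma apply_eq [K.HasOrthogonalProjection] (h : IsCompactResolvent A K R) {μ : ℂ} {u : H}
    (hu : u ∈ pmapEigenspace A μ) (h0 : u ≠ 0) : R u = (((1 + μ.re)⁻¹ : ℝ) : ℂ) • u := by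
  have h1 := Module.End.mem_eigenspace_iff.1 (h.pmapEigenspace_le μ hu)
  rw [Complex.ofReal_inv, Complex.ofReal_add, (h.eigenvalue_real hu h0).1, Complex.ofReal_one,
    add_comm]
  exact h1

/-- Only finitely many members of an orthonormal family of eigenvectors belong to eigenvalues below
a given bound. -/
lemma finite_sublevel [K.HasOrthogonalProjection] (h : IsCompactResolvent A K R) {ι : Type*}
    {b : ι → H} (hb : Orthonormal ℂ b) {ev : ι → ℂ} (hbm : ∀ i, b i ∈ pmapEigenspace A (ev i))
    (c : ℝ) : {i | (ev i).re ≤ c}.Finite := by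
  have hpos : ∀ i, 0 < 1 + (ev i).re := fun i => (h.eigenvalue_real (hbm i) (hb.ne_zero i)).2
  by_cases hc : 0 < 1 + c
  swap
  · convert Set.finite_empty
    ext i
    simp only [mem_ofPred_eq, mem_empty_iff_false, iff_false, not_le]
    linarith [hpos i]
  set t := (1 + c)⁻¹ with ht
  have htpos : 0 < t := inv_pos.2 hc
  have hcomp := h.compact.isCompact_closure_image_closedBall (f := (R : H →ₗ[ℂ] H)) 1
  -- Images of distinct eigenvectors below the bound are orthogonal of norm at least `t`, hence at
  -- distance at least `t`. A ball of radius `t / 2` therefore contains at most one of them, and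
  -- finitely many such balls cover the image of the unit ball.
  obtain ⟨T, hT, hcov⟩ := Metric.totallyBounded_iff.1 hcomp.totallyBounded (t / 2) (by positivity)
  have hmem : ∀ i, ∃ y ∈ T, R (b i) ∈ Metric.ball y (t / 2) := by
    intro i
    have : R (b i) ∈ ⋃ y ∈ T, Metric.ball y (t / 2) := by
      refine hcov (subset_closure ⟨b i, ?_, rfl⟩)
      simp [hb.1 i]
    simpa using this
  choose y hyT hy using hmem
  refine Set.Finite.of_injOn (f := y) (t := T) (fun i _ => hyT i) ?_ hT
  intro i hi j hj hij
  by_contra hne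
  have hd : dist (R (b i)) (R (b j)) < t := by
    have h1 := hy i
    have h2 := hy j
    rw [← hij] at h2
    rw [Metric.mem_ball] at h1 h2
    linarith [dist_triangle_right (R (b i)) (R (b j)) (y i)]
  rw [dist_eq_norm, h.apply_eq (hbm i) (hb.ne_zero i), h.apply_eq (hbm j) (hb.ne_zero j)] at hd
  set p := (1 + (ev i).re)⁻¹
  set q := (1 + (ev j).re)⁻¹
  have hp : t ≤ p := inv_anti₀ (hpos i) (by have : (ev i).re ≤ c := hi; linarith)
  have hsq : ‖(p : ℂ) • b i - (q : ℂ) • b j‖ ^ 2 = p ^ 2 + q ^ 2 := by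
    rw [@norm_sub_sq ℂ, inner_smul_left, inner_smul_right, hb.2 hne, norm_smul, norm_smul, hb.1 i,
      hb.1 j]
    simp
  have : ‖(p : ℂ) • b i - (q : ℂ) • b j‖ ^ 2 < t ^ 2 := by gcongr
  nlinarith [sq_nonneg q]

variable [CompleteSpace H]

lemma finiteDimensional [K.HasOrthogonalProjection] (h : IsCompactResolvent A K R) (μ : ℂ) :
    FiniteDimensional ℂ (pmapEigenspace A μ) := by
  by_cases hμ : μ + 1 = 0
  · have : pmapEigenspace A μ = ⊥ := by
      rw [eq_bot_iff]
      intro u hu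
      rw [h.mem_pmapEigenspace_iff, hμ, zero_smul] at hu
      exact hu.symm
    rw [this]
    infer_instance
  · have := ContinuousLinearMap.finite_dimensional_eigenspace h.compact _ (inv_ne_zero hμ)
    exact Submodule.finiteDimensional_of_le (h.pmapEigenspace_le μ)

/-- An orthonormal family of eigenvectors, with as many vectors for each eigenvalue as its
multiplicity, whose orthogonal complement is the kernel of the resolvent. -/
lemma exists_eigenbasis [K.HasOrthogonalProjection] (h : IsCompactResolvent A K R) :
    ∃ b : (Σ μ : ℂ, Fin (Module.finrank ℂ (pmapEigenspace A μ))) → H,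
      Orthonormal ℂ b ∧ (∀ i, b i ∈ pmapEigenspace A i.1) ∧
      ∀ x, (∀ i, inner ℂ (b i) x = 0) → R x = 0 := by
  have := h.finiteDimensional
  let v := fun μ => stdOrthonormalBasis ℂ (pmapEigenspace A μ)
  have hV : OrthogonalFamily ℂ (fun μ => pmapEigenspace A μ)
      fun μ => (pmapEigenspace A μ).subtypeₗᵢ := by
    intro μ ν hμν x y
    exact h.symm.orthogonalFamily_eigenspaces
      (fun e => hμν (add_right_cancel (inv_injective e)))
      ⟨x, h.pmapEigenspace_le μ x.2⟩ ⟨y, h.pmapEigenspace_le ν y.2⟩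
  refine ⟨fun i => v i.1 i.2, hV.orthonormal_sigma_orthonormal fun μ => (v μ).orthonormal,
    fun i => (v i.1 i.2).2, fun x hx => ?_⟩
  have hx' : ∀ μ, ∀ w ∈ pmapEigenspace A μ, inner ℂ w x = 0 := by
    intro μ w hw
    have hs : w = ∑ j, (v μ).repr ⟨w, hw⟩ j • (v μ j : H) := by
      refine (congrArg Subtype.val ((v μ).sum_repr ⟨w, hw⟩)).symm.trans ?_
      simp only [Submodule.coe_sum, Submodule.coe_smul]
    rw [hs, sum_inner]
    refine Finset.sum_eq_zero fun j _ => ?_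
    rw [inner_smul_left, hx ⟨μ, j⟩, mul_zero]
  -- The vector `x` may have a component in the kernel of `R`, so orthogonality is shown for `R x`.
  -- The eigenspace of `0` is handled by symmetry; every other eigenspace of `R` is one of `A`.
  have hmem : R x ∈ (⨆ μ, Module.End.eigenspace (R : H →ₗ[ℂ] H) μ)ᗮ := by
    rw [← Submodule.iInf_orthogonal, Submodule.mem_iInf]
    intro μ
    rw [Submodule.mem_orthogonal]
    intro w hw
    rw [Module.End.mem_eigenspace_iff] at hw
    have e : inner ℂ w (R x) = inner ℂ (R w) x := (h.symm w x).symm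
    have hw' : R w = μ • w := hw
    rw [e, hw', inner_smul_left]
    by_cases hμ : μ = 0
    · simp [hμ]
    · rw [hx' (μ⁻¹ - 1) w, mul_zero]
      rw [h.mem_pmapEigenspace_iff, hw', smul_smul, sub_add_cancel, inv_mul_cancel₀ hμ, one_smul]
  rwa [ContinuousLinearMap.orthogonalComplement_iSup_eigenspaces_eq_bot h.compact h.symm,
    Submodule.mem_bot] at hmem

/-- The operator has an eigenvalue sequence if its resolvent does not have finite rank. -/
lemma exists_isEigenvalueSequence [K.HasOrthogonalProjection] (h : IsCompactResolvent A K R)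
    (hinf : ∀ n : ℕ, ∃ W : Submodule ℂ H, n < Module.finrank ℂ W ∧ ∀ x ∈ W, R x = 0 → x = 0) :
    ∃ ev : ℕ → ℝ, IsEigenvalueSequence A ev := by
  classical
  obtain ⟨b, hb, hbm, htot⟩ := h.exists_eigenbasis
  have hI : Infinite (Σ μ : ℂ, Fin (Module.finrank ℂ (pmapEigenspace A μ))) := by
    rw [← not_finite_iff_infinite]
    intro hfin
    -- With finitely many eigenvectors, a test space of larger dimension would contain a nonzero
    -- vector orthogonal to all of them, which `R` would kill.
    have := Fintype.ofFinite (Σ μ : ℂ, Fin (Module.finrank ℂ (pmapEigenspace A μ)))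
    obtain ⟨W, hW, hW'⟩ :=
      hinf (Fintype.card (Σ μ : ℂ, Fin (Module.finrank ℂ (pmapEigenspace A μ))))
    obtain ⟨x, hx, hx0, hxe⟩ := exists_ne_zero_mem_of_finrank_gt W hW b
    exact hx0 (hW' x hx (htot x hxe))
  obtain ⟨σ, hσ⟩ := exists_equiv_nat_monotone
    (fun i : (Σ μ : ℂ, Fin (Module.finrank ℂ (pmapEigenspace A μ))) => i.1.re)
    (h.finite_sublevel hb hbm)
  have hreal : ∀ n, ((σ n).1.re : ℂ) = (σ n).1 := fun n =>
    (h.eigenvalue_real (hbm (σ n)) (hb.ne_zero _)).1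
  have hset : ∀ μ : ℂ, {n | ((σ n).1.re : ℂ) = μ} = σ.symm '' (Set.range (Sigma.mk μ)) := by
    intro μ
    ext n
    simp only [hreal, mem_ofPred_eq, mem_image, Equiv.symm_apply_eq, exists_eq_right, mem_range]
    constructor
    · rintro rfl
      exact ⟨(σ n).2, rfl⟩
    · rintro ⟨y, hy⟩
      rw [← hy]
  refine ⟨fun n => (σ n).1.re, hσ, h.finiteDimensional, fun μ => ?_, fun μ => ?_⟩
  · rw [hset]
    exact (Set.finite_range _).image _
  · rw [hset, Set.ncard_image_of_injective _ σ.symm.injective, ← Nat.card_coe_set_eq,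
      Nat.card_range_of_injective sigma_mk_injective, Nat.card_fin]

/-- The orthonormal sequence of eigenvectors belonging to an eigenvalue sequence. -/
lemma exists_eigenvectors [K.HasOrthogonalProjection] (h : IsCompactResolvent A K R) {ev : ℕ → ℝ}
    (hev : IsEigenvalueSequence A ev) :
    ∃ e : ℕ → H, Orthonormal ℂ e ∧ (∀ n, 0 < 1 + ev n) ∧
      (∀ n, R (e n) = (((1 + ev n)⁻¹ : ℝ) : ℂ) • e n) ∧
      ∀ x, (∀ n, inner ℂ (e n) x = 0) → R x = 0 := by
  obtain ⟨b, hb, hbm, htot⟩ := h.exists_eigenbasis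
  have heq : ∀ μ : ℂ, Nonempty ({n // (ev n : ℂ) = μ} ≃
      Fin (Module.finrank ℂ (pmapEigenspace A μ))) := by
    intro μ
    have : Finite {n // (ev n : ℂ) = μ} := hev.finite_fibre μ
    exact ⟨Finite.equivFinOfCardEq (hev.mult μ)⟩
  -- The fibre of `ev` over `μ` has as many elements as the basis of that eigenspace, so `ℕ` is
  -- matched with the eigenbasis fibre by fibre.
  let σ : ℕ ≃ (Σ μ : ℂ, Fin (Module.finrank ℂ (pmapEigenspace A μ))) :=
    (Equiv.sigmaFiberEquiv fun n => (ev n : ℂ)).symm.trans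
      (Equiv.sigmaCongrRight fun μ => (heq μ).some)
  have hσ : ∀ n, (σ n).1 = ev n := fun n => rfl
  have hmem : ∀ n, b (σ n) ∈ pmapEigenspace A (ev n) := fun n => hbm (σ n)
  refine ⟨fun n => b (σ n), hb.comp σ σ.injective, fun n => ?_, fun n => ?_, fun x hx => ?_⟩
  · simpa using (h.eigenvalue_real (hmem n) (hb.ne_zero _)).2
  · simpa using h.apply_eq (hmem n) (hb.ne_zero _)
  · exact htot x fun i => by simpa using hx (σ.symm i)

/-- Lower bound for the eigenvalues of the resolvent by the Rayleigh quotient on a test space. -/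
lemma le_of_rayleigh_le [K.HasOrthogonalProjection] (h : IsCompactResolvent A K R) {ev : ℕ → ℝ}
    (hev : IsEigenvalueSequence A ev) {n : ℕ} {W : Submodule ℂ H} (hW : n < Module.finrank ℂ W)
    {t : ℝ} (ht : ∀ x ∈ W, t * ‖x‖ ^ 2 ≤ (inner ℂ x (R x)).re) : t ≤ (1 + ev n)⁻¹ := by
  obtain ⟨e, he, hpos, heR, htot⟩ := h.exists_eigenvectors hev
  obtain ⟨x, hxW, hx0, hxe⟩ := exists_ne_zero_mem_of_finrank_gt W (by simpa using hW)
    (fun k : Fin n => e k)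
  -- On the closed span of the `e k` with `k ≥ n` the form of `R` is at most `(1 + ev n)⁻¹ ‖p‖²`.
  -- Since `x` is orthogonal to the earlier `e k`, it is `p + q` with `p ∈ N` and `q` orthogonal to
  -- all `e k`. Then `R q = 0`, so `q` adds to the norm but not to the form.
  set N : Submodule ℂ H := (Submodule.span ℂ (e '' Set.Ici n)).topologicalClosure with hN
  have : N.HasOrthogonalProjection := by
    have : CompleteSpace N := (Submodule.isClosed_topologicalClosure _).completeSpace_coe
    infer_instance
  have hform : ∀ p ∈ N, (inner ℂ p (R p)).re ≤ (1 + ev n)⁻¹ * ‖p‖ ^ 2 := by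
    have hcl : IsClosed {p : H | (inner ℂ p (R p)).re ≤ (1 + ev n)⁻¹ * ‖p‖ ^ 2} :=
      isClosed_le (by fun_prop) (by fun_prop)
    intro p hp
    refine closure_minimal (fun p hp => ?_) hcl hp
    obtain ⟨c, hc, rfl⟩ := (Finsupp.mem_span_image_iff_linearCombination ℂ).1 hp
    have := he.re_inner_sum_apply heR c.support c
    rw [mem_ofPred_eq, Finsupp.linearCombination_apply, Finsupp.sum, this.1, this.2,
      Finset.mul_sum]
    refine Finset.sum_le_sum fun k hk => ?_
    have hk : n ≤ k := (Finsupp.mem_supported _ _).1 hc hk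
    gcongr
    · exact hpos n
    · exact hev.monotone hk
  have horth : ∀ k < n, ∀ p ∈ N, inner ℂ (e k) p = 0 := by
    intro k hk p hp
    have hcl : IsClosed {p : H | inner ℂ (e k) p = 0} :=
      isClosed_eq (by fun_prop) (by fun_prop)
    refine closure_minimal (fun p hp => ?_) hcl hp
    refine Submodule.span_induction ?_ ?_ ?_ ?_ hp
    · rintro _ ⟨j, hj, rfl⟩
      exact he.2 (hk.trans_le hj).ne
    · simp
    · intro x y _ _ hx hy
      simp only [mem_ofPred_eq] at hx hy ⊢
      rw [inner_add_right, hx, hy, add_zero]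
    · intro a x _ hx
      simp only [mem_ofPred_eq] at hx ⊢
      rw [inner_smul_right, hx, mul_zero]
  obtain ⟨p, hp, q, hq, rfl⟩ := N.exists_add_mem_mem_orthogonal x
  have hRq : R q = 0 := by
    refine htot q fun k => ?_
    by_cases hk : k < n
    · have h1 := hxe ⟨k, hk⟩
      rwa [inner_add_right, horth k hk p hp, zero_add] at h1
    · exact (Submodule.mem_orthogonal _ _).1 hq _
        (subset_closure (Submodule.subset_span ⟨k, not_lt.1 hk, rfl⟩))
  have h1 := ht _ hxW
  have h2 : inner ℂ (p + q) (R (p + q)) = inner ℂ p (R p) := by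
    rw [map_add, hRq, add_zero, inner_add_left]
    have : inner ℂ q (R p) = inner ℂ (R q) p := (h.symm q p).symm
    rw [this, hRq, inner_zero_left, add_zero]
  have h3 : ‖p + q‖ ^ 2 = ‖p‖ ^ 2 + ‖q‖ ^ 2 := by
    rw [@norm_add_sq ℂ, (Submodule.mem_orthogonal _ _).1 hq p hp]
    simp
  rw [h2] at h1
  have h4 := hform p hp
  have h5 : 0 < ‖p + q‖ ^ 2 := by positivity
  have h6 : (1 + ev n)⁻¹ * ‖p‖ ^ 2 ≤ (1 + ev n)⁻¹ * ‖p + q‖ ^ 2 := by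
    have := (inv_pos.2 (hpos n)).le
    refine mul_le_mul_of_nonneg_left ?_ this
    rw [h3]
    linarith [sq_nonneg ‖q‖]
  exact le_of_mul_le_mul_right (by linarith) h5

/-- The Rayleigh quotient of the resolvent on the span of the first eigenvectors. -/
lemma exists_rayleigh_ge [K.HasOrthogonalProjection] (h : IsCompactResolvent A K R) {ev : ℕ → ℝ}
    (hev : IsEigenvalueSequence A ev) (n : ℕ) : ∃ W : Submodule ℂ H, n < Module.finrank ℂ W ∧
      ∀ x ∈ W, (1 + ev n)⁻¹ * ‖x‖ ^ 2 ≤ (inner ℂ x (R x)).re := by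
  obtain ⟨e, he, hpos, heR, -⟩ := h.exists_eigenvectors hev
  -- Eigenvalues are numbered from `0`, so reaching `ev n` takes `n + 1` vectors.
  let e' : Fin (n + 1) → H := fun k => e k
  have he' : Orthonormal ℂ e' := he.comp _ Fin.val_injective
  refine ⟨Submodule.span ℂ (Set.range e'), ?_, fun x hx => ?_⟩
  · rw [finrank_span_eq_card he'.linearIndependent]
    simp
  · obtain ⟨c, rfl⟩ := (Submodule.mem_span_range_iff_exists_fun ℂ).1 hx
    have := he'.re_inner_sum_apply (m := fun k => (1 + ev k)⁻¹) (fun k => heR k) Finset.univ c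
    rw [this.1, this.2, Finset.mul_sum]
    refine Finset.sum_le_sum fun k _ => ?_
    gcongr
    · exact hpos k
    · exact hev.monotone (Nat.lt_succ_iff.1 k.2)

/-- Stability of the eigenvalues under perturbation of the resolvent. -/
lemma inv_sub_le [K.HasOrthogonalProjection] (h : IsCompactResolvent A K R) {ev : ℕ → ℝ}
    (hev : IsEigenvalueSequence A ev) {A' : H →ₗ.[ℂ] H} {K' : Submodule ℂ H} {R' : H →L[ℂ] H}
    [K'.HasOrthogonalProjection] (h' : IsCompactResolvent A' K' R') {ev' : ℕ → ℝ}
    (hev' : IsEigenvalueSequence A' ev') {δ : ℝ} (hδ : ∀ f, ‖R f - R' f‖ ≤ δ * ‖f‖) (n : ℕ) :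
    (1 + ev n)⁻¹ - δ ≤ (1 + ev' n)⁻¹ := by
  obtain ⟨W, hW, hx⟩ := h.exists_rayleigh_ge hev n
  -- The span of the first eigenvectors of `R` serves as test space for `R'`, at the cost of `δ` in
  -- the Rayleigh quotient.
  refine h'.le_of_rayleigh_le hev' hW fun x hxW => ?_
  have h1 := hx x hxW
  have h2 : (inner ℂ x (R x - R' x)).re ≤ ‖x‖ * ‖R x - R' x‖ := re_inner_le_norm (𝕜 := ℂ) x _
  rw [inner_sub_right, Complex.sub_re] at h2
  have h3 := mul_le_mul_of_nonneg_left (hδ x) (norm_nonneg x)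
  nlinarith

/-- Stability of the eigenvalues of the operator under perturbation of the resolvent, in terms of
a test space common to both operators. -/
lemma abs_sub_le [K.HasOrthogonalProjection] (h : IsCompactResolvent A K R) {ev : ℕ → ℝ}
    (hev : IsEigenvalueSequence A ev) {A' : H →ₗ.[ℂ] H} {K' : Submodule ℂ H} {R' : H →L[ℂ] H}
    [K'.HasOrthogonalProjection] (h' : IsCompactResolvent A' K' R') {ev' : ℕ → ℝ}
    (hev' : IsEigenvalueSequence A' ev') {δ : ℝ} (hδ : ∀ f, ‖R f - R' f‖ ≤ δ * ‖f‖) {n : ℕ}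
    {W : Submodule ℂ H} (hW : n < Module.finrank ℂ W) {t : ℝ} (htpos : 0 < t)
    (ht : ∀ x ∈ W, t * ‖x‖ ^ 2 ≤ (inner ℂ x (R x)).re)
    (ht' : ∀ x ∈ W, t * ‖x‖ ^ 2 ≤ (inner ℂ x (R' x)).re) :
    |ev n - ev' n| ≤ δ / t ^ 2 := by
  have a1 := h.le_of_rayleigh_le hev hW ht
  have a2 := h'.le_of_rayleigh_le hev' hW ht'
  have b1 := h.inv_sub_le hev h' hev' hδ n
  have b2 := h'.inv_sub_le hev' h hev (fun f => by rw [norm_sub_rev]; exact hδ f) n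
  have p1 : 0 < 1 + ev n := inv_pos.1 (htpos.trans_le a1)
  have p2 : 0 < 1 + ev' n := inv_pos.1 (htpos.trans_le a2)
  set m := (1 + ev n)⁻¹ with hm
  set m' := (1 + ev' n)⁻¹ with hm'
  have hab : |m' - m| ≤ δ := abs_le.2 ⟨by linarith, by linarith⟩
  -- Both `m` and `m'` are at least `t`, which is where the factor `1 / t ^ 2` comes from.
  have e : ev n - ev' n = (m' - m) / (m * m') := by
    rw [hm, hm']
    field_simp
    ring
  rw [e, abs_div, abs_of_pos (mul_pos (htpos.trans_le a1) (htpos.trans_le a2))]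
  have hδ0 : 0 ≤ δ := (abs_nonneg _).trans hab
  rw [sq]
  gcongr

end IsCompactResolvent

end Spectral

/-! ### Weak solutions of abstract forms and their comparison. -/

section Forms

variable {H G : Type*} [NormedAddCommGroup H] [InnerProductSpace ℂ H]
  [NormedAddCommGroup G] [InnerProductSpace ℂ G]

/-- `u = R f`, `g = Γ f` is the weak solution `(u, g) ∈ D` of
`⟪S g, S k⟫ + ⟪u, v⟫ = ⟪f, v⟫` for all `(v, k) ∈ D`. -/
structure IsFormSolution (D : Submodule ℂ (H × G)) (S : G →L[ℂ] G) (R : H →L[ℂ] H)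
    (Γ : H →L[ℂ] G) : Prop where
  mem : ∀ f, (R f, Γ f) ∈ D
  weak : ∀ f, ∀ q ∈ D, inner ℂ (S q.2) (S (Γ f)) + inner ℂ q.1 (R f) = inner ℂ q.1 f

/-- Coercive forms on closed domains admit weak solutions. -/
lemma exists_isFormSolution [CompleteSpace H] [CompleteSpace G] {D : Submodule ℂ (H × G)}
    (hD : IsClosed (D : Set (H × G))) {S : G →L[ℂ] G} {c : ℝ}
    (hS : ∀ p ∈ D, ‖p.2‖ ≤ c * ‖S p.2‖) :
    ∃ (R : H →L[ℂ] H) (Γ : H →L[ℂ] G), IsFormSolution D S R Γ := by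
  let e := WithLp.prodContinuousLinearEquiv 2 ℂ H G
  -- `J` carries the energy product on `D` to the product of a Hilbert sum. Coercivity bounds it
  -- below, so its range is closed.
  let J : D →L[ℂ] WithLp 2 (H × G) := (e.symm : H × G →L[ℂ] WithLp 2 (H × G)) ∘L
    ((ContinuousLinearMap.fst ℂ H G).prod (S ∘L ContinuousLinearMap.snd ℂ H G)) ∘L D.subtypeL
  have hJ1 : ∀ p : D, (J p).fst = p.1.1 := fun p => rfl
  have hJ2 : ∀ p : D, (J p).snd = S p.1.2 := fun p => rfl
  have hbound : ∀ p : D, ‖p‖ ≤ (max 1 c).toNNReal * ‖J p‖ := by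
    intro p
    have h0 : (0 : ℝ) ≤ max 1 c := le_max_of_le_left zero_le_one
    rw [Real.coe_toNNReal _ h0]
    have h1 : ‖p.1.1‖ ≤ ‖J p‖ := WithLp.norm_fst_le _ (J p)
    have h2 : ‖S p.1.2‖ ≤ ‖J p‖ := WithLp.norm_snd_le _ (J p)
    change max ‖p.1.1‖ ‖p.1.2‖ ≤ _
    refine max_le ?_ ?_
    · exact h1.trans (le_mul_of_one_le_left (norm_nonneg _) (le_max_left _ _))
    · exact (hS _ p.2).trans (mul_le_mul (le_max_right _ _) h2 (norm_nonneg _) h0)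
  have hanti : AntilipschitzWith (max 1 c).toNNReal J := J.antilipschitz_of_bound hbound
  have : CompleteSpace D := hD.completeSpace_coe
  have hclosed : IsClosed (Set.range J) := hanti.isClosed_range J.uniformContinuous
  let E := J.equivRange hanti.injective hclosed
  let N := (J : D →ₗ[ℂ] WithLp 2 (H × G)).range
  have : CompleteSpace N := by
    have hN : IsClosed (N : Set (WithLp 2 (H × G))) := by rwa [LinearMap.coe_range]
    exact hN.completeSpace_coe
  -- The weak equation says exactly that `(f, 0)` minus the image of the solution is orthogonal to
  -- the range of `J`.
  let sol : H →L[ℂ] D := (E.symm : N →L[ℂ] D) ∘L N.orthogonalProjectionOnto ∘L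
    (e.symm : H × G →L[ℂ] WithLp 2 (H × G)) ∘L ContinuousLinearMap.inl ℂ H G
  refine ⟨ContinuousLinearMap.fst ℂ H G ∘L D.subtypeL ∘L sol,
    ContinuousLinearMap.snd ℂ H G ∘L D.subtypeL ∘L sol, fun f => (sol f).2, fun f q hq => ?_⟩
  have h1 : J (sol f) = N.orthogonalProjectionOnto (e.symm (f, 0)) :=
    congrArg Subtype.val (E.apply_symm_apply (N.orthogonalProjectionOnto (e.symm (f, 0))))
  have h2 : inner ℂ (J ⟨q, hq⟩) (J (sol f)) = inner ℂ (J ⟨q, hq⟩) (e.symm (f, 0)) := by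
    rw [h1]
    exact Submodule.inner_orthogonalProjectionOnto_eq_of_mem_left (K := N) ⟨J ⟨q, hq⟩, ⟨_, rfl⟩⟩ _
  rw [WithLp.prod_inner_apply, WithLp.prod_inner_apply] at h2
  change inner ℂ q.1 (sol f).1.1 + inner ℂ (S q.2) (S (sol f).1.2) =
    inner ℂ q.1 f + inner ℂ (S q.2) 0 at h2
  rw [inner_zero_right, add_zero, add_comm] at h2
  exact h2

namespace IsFormSolution

variable {D : Submodule ℂ (H × G)} {S : G →L[ℂ] G} {R : H →L[ℂ] H} {Γ : H →L[ℂ] G}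

/-- Each weak equation is tested with the other solution; the two left sides are complex conjugates.
-/
lemma isSymmetric (h : IsFormSolution D S R Γ) : (R : H →ₗ[ℂ] H).IsSymmetric := by
  intro f f'
  have h1 := h.weak f' _ (h.mem f)
  have h2 := congrArg conj (h.weak f _ (h.mem f'))
  rw [map_add, inner_conj_symm, inner_conj_symm, inner_conj_symm] at h2
  exact h1.symm.trans h2

lemma re_inner_eq (h : IsFormSolution D S R Γ) (f : H) :
    (inner ℂ f (R f)).re = ‖S (Γ f)‖ ^ 2 + ‖R f‖ ^ 2 := by
  have h1 := congrArg Complex.re (h.weak f _ (h.mem f))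
  have h2 : inner ℂ (R f) f = inner ℂ f (R f) := h.isSymmetric f f
  rw [← h2, ← h1, Complex.add_re]
  congr 1
  · exact inner_self_eq_norm_sq (𝕜 := ℂ) _
  · exact inner_self_eq_norm_sq (𝕜 := ℂ) _

/-- Lower bound for the quadratic form of the resolvent in terms of the form. -/
lemma mul_norm_sq_le (h : IsFormSolution D S R Γ) {u : H} {g : G} (hu : (u, g) ∈ D) {T : ℝ}
    (hT : 0 < T) (hb : ‖S g‖ ^ 2 + ‖u‖ ^ 2 ≤ T * ‖u‖ ^ 2) :
    T⁻¹ * ‖u‖ ^ 2 ≤ (inner ℂ u (R u)).re := by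
  have h1 := congrArg Complex.re (h.weak u _ hu)
  rw [Complex.add_re] at h1
  -- The energy product of `(u, g)` with the solution for datum `u` is `‖u‖²`. Expanding the
  -- nonnegative energy of `(u, g) - T (R u, Γ u)` and using `hb` gives `T ‖u‖² ≤ T² ⟪u, R u⟫`.
  have h1' : (inner ℂ u u).re = ‖u‖ ^ 2 := inner_self_eq_norm_sq (𝕜 := ℂ) u
  have h2 := h.re_inner_eq u
  have h3 : ‖u - (T : ℂ) • R u‖ ^ 2 = ‖u‖ ^ 2 - 2 * (T * (inner ℂ u (R u)).re) +
      T ^ 2 * ‖R u‖ ^ 2 := by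
    rw [@norm_sub_sq ℂ, inner_smul_right, norm_smul, mul_pow]
    simp
  have h4 : ‖S g - (T : ℂ) • S (Γ u)‖ ^ 2 = ‖S g‖ ^ 2 - 2 * (T * (inner ℂ (S g) (S (Γ u))).re) +
      T ^ 2 * ‖S (Γ u)‖ ^ 2 := by
    rw [@norm_sub_sq ℂ, inner_smul_right, norm_smul, mul_pow]
    simp
  have h5 := sq_nonneg ‖u - (T : ℂ) • R u‖
  have h6 := sq_nonneg ‖S g - (T : ℂ) • S (Γ u)‖
  dsimp only at h1
  have h7 : T * ‖u‖ ^ 2 ≤ T * (T * (inner ℂ u (R u)).re) := by nlinarith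
  have h8 := le_of_mul_le_mul_left h7 hT
  rw [inv_mul_le_iff₀ hT]
  exact h8

/-- Uniqueness of weak solutions: the difference of two, tested with itself, has zero energy. -/
lemma eq_of_forall (h : IsFormSolution D S R Γ) {u f : H} {g : G} (hu : (u, g) ∈ D)
    (hw : ∀ q ∈ D, inner ℂ (S q.2) (S g) + inner ℂ q.1 u = inner ℂ q.1 f) : R f = u := by
  have hd : (R f, Γ f) - (u, g) ∈ D := D.sub_mem (h.mem f) hu
  have h1 := h.weak f _ hd
  have h2 := hw _ hd
  rw [← h1] at h2
  have h3 : inner ℂ (S (Γ f - g)) (S (Γ f - g)) + inner ℂ (R f - u) (R f - u) = 0 := by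
    conv_lhs => rw [map_sub, inner_sub_right, inner_sub_right]
    simp only [Prod.mk_sub_mk, map_sub] at h2 ⊢
    linear_combination -h2
  have h4 := congrArg Complex.re h3
  rw [Complex.add_re] at h4
  have h5 : (inner ℂ (S (Γ f - g)) (S (Γ f - g))).re = ‖S (Γ f - g)‖ ^ 2 :=
    inner_self_eq_norm_sq (𝕜 := ℂ) _
  have h6 : (inner ℂ (R f - u) (R f - u)).re = ‖R f - u‖ ^ 2 := inner_self_eq_norm_sq (𝕜 := ℂ) _
  rw [h5, h6, Complex.zero_re] at h4
  have h7 : ‖R f - u‖ ^ 2 = 0 := by nlinarith [sq_nonneg ‖S (Γ f - g)‖, sq_nonneg ‖R f - u‖]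
  exact sub_eq_zero.1 (norm_eq_zero.1 (pow_eq_zero_iff two_ne_zero |>.1 h7))

/-- The weak solution operator is the resolvent of the operator associated with the form. -/
lemma isCompactResolvent (h : IsFormSolution D S R Γ) {A : H →ₗ.[ℂ] H} {K : Submodule ℂ H}
    (hDK : ∀ p ∈ D, p.1 ∈ K)
    (hA : ∀ u f, (u, f) ∈ A.graph ↔ f ∈ K ∧ ∃ g, (u, g) ∈ D ∧
      ∀ q ∈ D, inner ℂ (S q.2) (S g) = inner ℂ q.1 f)
    (hR : IsCompactOperator R) : IsCompactResolvent A K R where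
  right_inv f hf := by
    have hg : (R f, f - R f) ∈ A.graph := by
      rw [hA]
      refine ⟨K.sub_mem hf (hDK _ (h.mem f)), Γ f, h.mem f, fun q hq => ?_⟩
      rw [inner_sub_right, ← h.weak f q hq, add_sub_cancel_right]
    obtain ⟨y, hy1, hy2⟩ := (LinearPMap.mem_graph_iff _).1 hg
    dsimp only at hy1 hy2
    have hd : R f ∈ A.domain := hy1 ▸ y.2
    refine ⟨hd, ?_⟩
    obtain rfl : y = ⟨R f, hd⟩ := Subtype.ext hy1
    rw [hy2, sub_add_cancel]
  left_inv u := by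
    obtain ⟨-, g, hg, hw⟩ := (hA u (A u)).1 (A.mem_graph u)
    refine h.eq_of_forall hg fun q hq => ?_
    rw [inner_add_right, hw q hq]
  eq_zero f hf := by
    refine h.eq_of_forall (g := 0) D.zero_mem fun q hq => ?_
    rw [(Submodule.mem_orthogonal _ _).1 hf _ (hDK q hq), map_zero, inner_zero_right,
      inner_zero_right, add_zero]
  domain_le u hu := by
    obtain ⟨-, g, hg, -⟩ := (hA u (A ⟨u, hu⟩)).1 (A.mem_graph ⟨u, hu⟩)
    exact hDK _ hg
  compact := hR
  symm := h.isSymmetric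
  nonneg x := by
    rw [h.re_inner_eq]
    positivity

/-- Comparison of the weak solutions of a strongly penalized form and of its restriction to the
subspace where the penalized part vanishes. -/
lemma norm_sub_le (h : IsFormSolution D S R Γ) {V : Submodule ℂ (H × G)} {S₀ S₁ : G →L[ℂ] G}
    {R₀ : H →L[ℂ] H} {Γ₀ : H →L[ℂ] G} (h₀ : IsFormSolution V S₀ R₀ Γ₀) (hVD : V ≤ D)
    (hS₀ : ∀ v ∈ V, ∀ k, inner ℂ (S v.2) (S k) = inner ℂ (S₀ v.2) (S₀ k))
    (hS₁ : ∀ v ∈ V, ∀ k, inner ℂ (S v.2) (S k) = inner ℂ (S₁ v.2) (S₁ k)) {c : ℝ}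
    (hc : ∀ p ∈ D, ∃ v ∈ V, ‖S₁ (p.2 - v.2)‖ ^ 2 + ‖p.1 - v.1‖ ^ 2 ≤ c * ‖S p.2‖ ^ 2)
    (hc0 : 0 ≤ c) (f : H) :
    ‖R f - R₀ f‖ ≤ c * ‖f‖ := by
  set w := R f - R₀ f with hw
  set γ := Γ f - Γ₀ f with hγ
  have hzD : (w, γ) ∈ D := D.sub_mem (h.mem f) (hVD (h₀.mem f))
  have horth : ∀ v ∈ V, inner ℂ (S v.2) (S γ) + inner ℂ v.1 w = 0 := by
    intro v hv
    have h1 := h.weak f v (hVD hv)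
    have h2 := h₀.weak f v hv
    rw [← hS₀ v hv] at h2
    rw [hγ, hw, map_sub, inner_sub_right, inner_sub_right]
    linear_combination h1 - h2
  -- the energy of the difference
  have henergy : ‖S γ‖ ^ 2 + ‖w‖ ^ 2 ≤ ‖w‖ * ‖f‖ := by
    have h1 := h.weak f _ hzD
    -- Testing orthogonality with the limit solution removes its contribution, so the energy of `w`
    -- equals `⟪w, f⟫`.
    have h2 := congrArg conj (horth _ (h₀.mem f))
    rw [map_add, inner_conj_symm, inner_conj_symm, map_zero] at h2
    have h3 : inner ℂ (S γ) (S γ) + inner ℂ w w = inner ℂ w f := by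
      have e1 : inner ℂ (S γ) (S γ) = inner ℂ (S γ) (S (Γ f)) - inner ℂ (S γ) (S (Γ₀ f)) := by
        rw [← inner_sub_right, ← map_sub]
      have e2 : inner ℂ w w = inner ℂ w (R f) - inner ℂ w (R₀ f) := by
        rw [← inner_sub_right]
      rw [e1, e2]
      linear_combination h1 - h2
    have h4 := congrArg Complex.re h3
    have h5 : (inner ℂ (S γ) (S γ)).re = ‖S γ‖ ^ 2 := inner_self_eq_norm_sq (𝕜 := ℂ) _
    have h6 : (inner ℂ w w).re = ‖w‖ ^ 2 := inner_self_eq_norm_sq (𝕜 := ℂ) _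
    rw [Complex.add_re, h5, h6] at h4
    rw [h4]
    exact re_inner_le_norm (𝕜 := ℂ) w f
  obtain ⟨v, hv, hcv⟩ := hc _ hzD
  -- the difference is the projection of itself onto the orthogonal complement of `V`
  have hproj : ‖w‖ ^ 2 ≤ c * ‖S γ‖ ^ 2 := by
    refine le_trans ?_ hcv
    have h1 := congrArg Complex.re (horth v hv)
    -- For `v` in `V` the penalty is invisible, so the orthogonality also holds with `S₁`, and
    -- Pythagoras applies in that norm. Using `S` itself would put the penalty on the correction
    -- `p.2 - v.2`.
    rw [hS₁ v hv, Complex.add_re, Complex.zero_re] at h1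
    have h2 : ‖S₁ (γ - v.2)‖ ^ 2 =
        ‖S₁ γ‖ ^ 2 - 2 * (inner ℂ (S₁ v.2) (S₁ γ)).re + ‖S₁ v.2‖ ^ 2 := by
      rw [map_sub, @norm_sub_sq ℂ, ← inner_re_symm]
      rfl
    have h3 : ‖w - v.1‖ ^ 2 = ‖w‖ ^ 2 - 2 * (inner ℂ v.1 w).re + ‖v.1‖ ^ 2 := by
      rw [@norm_sub_sq ℂ, ← inner_re_symm]
      rfl
    rw [h2, h3]
    nlinarith [sq_nonneg ‖S₁ γ‖, sq_nonneg ‖S₁ v.2‖, sq_nonneg ‖v.1‖]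
  by_cases hw0 : ‖w‖ = 0
  · rw [hw0]
    positivity
  · have hwpos : 0 < ‖w‖ := lt_of_le_of_ne (norm_nonneg _) (Ne.symm hw0)
    have h1 : ‖S γ‖ ^ 2 ≤ ‖w‖ * ‖f‖ := by linarith [sq_nonneg ‖w‖]
    have h2 : ‖w‖ * ‖w‖ ≤ ‖w‖ * (c * ‖f‖) := by
      have := mul_le_mul_of_nonneg_left h1 hc0
      nlinarith
    exact le_of_mul_le_mul_left h2 hwpos

end IsFormSolution

end Forms

/-! ### Primitives, weak derivatives and multiplication operators on the unit cell. -/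

instance : IsProbabilityMeasure cellMeasure :=
  ⟨by simp [cellMeasure]⟩

/-- The primitive on the unit cell vanishing at `0`. -/
def cellPrimitive (g : ℝ → ℂ) (y : ℝ) : ℂ := ∫ t in (0 : ℝ)..y, g t ∂cellMeasure

lemma continuous_cellPrimitive {g : ℝ → ℂ} (hg : Integrable g cellMeasure) :
    Continuous (cellPrimitive g) :=
  intervalIntegral.continuous_primitive (fun _ _ => hg.intervalIntegrable) 0

lemma cellPrimitive_zero (g : ℝ → ℂ) : cellPrimitive g 0 = 0 :=
  intervalIntegral.integral_same

/-- The measure has no mass below `0`; the half-line form is the one that fits an indicator of `{t ≤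
y}` in Fubini's theorem. -/
lemma cellPrimitive_eq_setIntegral (g : ℝ → ℂ) {y : ℝ} (hy : 0 ≤ y) :
    cellPrimitive g y = ∫ t in Iic y, g t ∂cellMeasure := by
  rw [cellPrimitive, intervalIntegral.integral_of_le hy, cellMeasure,
    Measure.restrict_restrict measurableSet_Ioc, Measure.restrict_restrict measurableSet_Iic]
  congr 2
  ext t
  simp only [mem_inter_iff, mem_Ioc, mem_Iic, mem_Ioo]
  tauto

lemma cellPrimitive_one (g : ℝ → ℂ) : cellPrimitive g 1 = ∫ t, g t ∂cellMeasure := by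
  rw [cellPrimitive_eq_setIntegral g zero_le_one, cellMeasure,
    Measure.restrict_restrict measurableSet_Iic]
  congr 2
  ext t
  simp only [mem_inter_iff, mem_Iic, mem_Ioo]
  exact ⟨fun h => h.2, fun h => ⟨h.2.le, h⟩⟩

/-- The integral of `φ'` over `(t, 1)` for a function vanishing near `1`. -/
lemma setIntegral_deriv_Ici {φ : ℝ → ℝ} (hφ : ContDiff ℝ ∞ φ) (hs : tsupport φ ⊆ Ioo 0 1) {t : ℝ}
    (ht : t ∈ Ioo (0 : ℝ) 1) : ∫ y in Ici t, deriv φ y ∂cellMeasure = -φ t := by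
  have h1 : φ 1 = 0 := image_eq_zero_of_notMem_tsupport fun h => by simpa using hs h
  have h2 : ∫ y in t..1, deriv φ y = φ 1 - φ t :=
    intervalIntegral.integral_deriv_eq_sub
      (fun x _ => (hφ.differentiable (by simp)).differentiableAt)
      ((hφ.continuous_deriv (by simp)).intervalIntegrable _ _)
  rw [h1, zero_sub, intervalIntegral.integral_of_le ht.2.le, ← integral_Icc_eq_integral_Ioc,
    integral_Icc_eq_integral_Ico] at h2
  rw [← h2, cellMeasure, Measure.restrict_restrict measurableSet_Ici]
  congr 2
  ext y
  simp only [mem_inter_iff, mem_Ici, mem_Ioo, mem_Ico]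
  exact ⟨fun h => ⟨h.1, h.2.2⟩, fun h => ⟨h.1, ht.1.trans_le h.1, h.2⟩⟩

/-- Integration by parts against the primitive of an integrable function. -/
lemma integral_deriv_smul_cellPrimitive {g : ℝ → ℂ} (hg : Integrable g cellMeasure) {φ : ℝ → ℝ}
    (hφ : ContDiff ℝ ∞ φ) (hc : HasCompactSupport φ) (hs : tsupport φ ⊆ Ioo 0 1) :
    ∫ y in Ioo (0 : ℝ) 1, deriv φ y • cellPrimitive g y = -∫ y in Ioo (0 : ℝ) 1, φ y • g y := by
  have hφ' : Integrable (deriv φ) cellMeasure :=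
    ((hφ.continuous_deriv (by simp)).integrable_of_hasCompactSupport hc.deriv).restrict
  -- Fubini on the triangle `t ≤ y` replaces differentiation of the primitive, so integrability of
  -- `g` suffices.
  let F : ℝ → ℝ → ℂ := fun y t => {p : ℝ × ℝ | p.2 ≤ p.1}.indicator
    (fun p => deriv φ p.1 • g p.2) (y, t)
  have hF : Integrable (Function.uncurry F) (cellMeasure.prod cellMeasure) := by
    have hm : MeasurableSet {p : ℝ × ℝ | p.2 ≤ p.1} :=
      measurableSet_le measurable_snd measurable_fst
    exact (hφ'.smul_prod hg).indicator hm
  have hswap := integral_integral_swap hF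
  have hmem : ∀ᵐ y ∂cellMeasure, y ∈ Ioo (0 : ℝ) 1 := ae_restrict_mem measurableSet_Ioo
  have h1 : ∫ y, ∫ t, F y t ∂cellMeasure ∂cellMeasure =
      ∫ y in Ioo (0 : ℝ) 1, deriv φ y • cellPrimitive g y := by
    refine integral_congr_ae ?_
    filter_upwards [hmem] with y hy
    rw [cellPrimitive_eq_setIntegral g hy.1.le, ← integral_smul,
      ← integral_indicator measurableSet_Iic]
    rfl
  have h2 : ∫ t, ∫ y, F y t ∂cellMeasure ∂cellMeasure = ∫ t in Ioo (0 : ℝ) 1, (-φ t) • g t := by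
    refine integral_congr_ae ?_
    filter_upwards [hmem] with t ht
    rw [← setIntegral_deriv_Ici hφ hs ht, ← integral_smul_const,
      ← integral_indicator measurableSet_Ici]
    rfl
  rw [← h1, hswap, h2, ← integral_neg]
  simp only [neg_smul]

/-- A function whose integrals against all test functions vanish is zero on the cell. -/
lemma ae_eq_zero_of_forall_integral_smul_eq_zero {g : ℝ → ℂ} (hg : Integrable g cellMeasure)
    (h : ∀ φ : ℝ → ℝ, ContDiff ℝ ∞ φ → HasCompactSupport φ → tsupport φ ⊆ Ioo 0 1 →
      ∫ y in Ioo (0 : ℝ) 1, φ y • g y = 0) : g =ᵐ[cellMeasure] 0 := by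
  refine (ae_restrict_iff' measurableSet_Ioo).2 ?_
  refine isOpen_Ioo.ae_eq_zero_of_integral_contDiff_smul_eq_zero
    (IntegrableOn.locallyIntegrableOn hg) fun φ hφ hc hs => ?_
  rw [← h φ hφ hc hs]
  refine (setIntegral_eq_integral_of_forall_compl_eq_zero fun y hy => ?_).symm
  rw [image_eq_zero_of_notMem_tsupport fun hy' => hy (hs hy'), zero_smul]

/-- A test function on the cell with zero mean is the derivative of a test function. -/
lemma exists_deriv_eq_of_integral_eq_zero {χ : ℝ → ℝ} (hχ : ContDiff ℝ ∞ χ)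
    (hc : HasCompactSupport χ) (hs : tsupport χ ⊆ Ioo 0 1) (h0 : ∫ y, χ y = 0) :
    ∃ φ : ℝ → ℝ, ContDiff ℝ ∞ φ ∧ HasCompactSupport φ ∧ tsupport φ ⊆ Ioo 0 1 ∧ deriv φ = χ := by
  obtain ⟨a, b, ha, hb, hab⟩ : ∃ a b : ℝ, 0 < a ∧ b < 1 ∧ tsupport χ ⊆ Icc a b := by
    rcases (tsupport χ).eq_empty_or_nonempty with he | hne
    -- `Icc 1 0` is empty and still meets `0 < a` and `b < 1`.
    · exact ⟨1, 0, by simp, by simp, by simp [he]⟩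
    · have hK : IsCompact (tsupport χ) := hc
      exact ⟨sInf (tsupport χ), sSup (tsupport χ), (hs (hK.sInf_mem hne)).1,
        (hs (hK.sSup_mem hne)).2, fun x hx =>
          ⟨csInf_le hK.bddBelow hx, le_csSup hK.bddAbove hx⟩⟩
  have hzero : ∀ t, t ∉ Icc a b → χ t = 0 := fun t ht =>
    image_eq_zero_of_notMem_tsupport fun h => ht (hab h)
  have hsupp : Function.support (fun y => ∫ t in (0 : ℝ)..y, χ t) ⊆ Icc a b := by
    intro y hy
    by_contra hy'
    refine hy ?_
    rcases lt_or_ge y a with hya | hya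
    · have : ∫ t in (0 : ℝ)..y, χ t = ∫ t in (0 : ℝ)..y, 0 := by
        refine intervalIntegral.integral_congr fun t ht => hzero t fun hta => ?_
        rcases Set.mem_uIcc.1 ht with h | h
        · linarith [h.2, hta.1]
        · linarith [h.2, hta.1]
      simpa using this
    -- Beyond `b` the primitive is the whole integral of `χ`; only here is the zero mean needed.
    · have hby : b < y := not_le.1 fun h => hy' ⟨hya, h⟩
      change ∫ t in (0 : ℝ)..y, χ t = 0
      rw [intervalIntegral.integral_eq_integral_of_support_subset, h0]
      intro t ht
      have : t ∈ Icc a b := by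
        by_contra h
        exact ht (hzero t h)
      exact ⟨ha.trans_le this.1, this.2.trans hby.le⟩
  have htsupp : tsupport (fun y => ∫ t in (0 : ℝ)..y, χ t) ⊆ Icc a b :=
    closure_minimal hsupp isClosed_Icc
  have hderiv : deriv (fun y => ∫ t in (0 : ℝ)..y, χ t) = χ := by
    funext y
    exact hχ.continuous.deriv_integral χ 0 y
  refine ⟨fun y => ∫ t in (0 : ℝ)..y, χ t, ?_, ?_, ?_, hderiv⟩
  · rw [contDiff_infty_iff_deriv, hderiv]
    exact ⟨fun y => (intervalIntegral.integral_hasDerivAt_right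
      (hχ.continuous.intervalIntegrable _ _) (hχ.continuous.stronglyMeasurableAtFilter _ _)
      hχ.continuous.continuousAt).differentiableAt, hχ⟩
  · exact HasCompactSupport.of_support_subset_isCompact isCompact_Icc hsupp
  · exact htsupp.trans fun t ht => ⟨ha.trans_le ht.1, ht.2.trans_lt hb⟩

lemma exists_testFunction_integral_eq_one : ∃ ψ : ℝ → ℝ, ContDiff ℝ ∞ ψ ∧ HasCompactSupport ψ ∧
    tsupport ψ ⊆ Ioo 0 1 ∧ ∫ y, ψ y = 1 := by
  let f : ContDiffBump (1 / 2 : ℝ) := ⟨1 / 8, 1 / 4, by norm_num, by norm_num⟩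
  refine ⟨f.normed volume, f.contDiff_normed, f.hasCompactSupport_normed, ?_, f.integral_normed⟩
  rw [f.tsupport_normed_eq, Real.closedBall_eq_Icc]
  intro x hx
  have h1 := hx.1
  have h2 := hx.2
  simp only [f] at h1 h2
  constructor <;> linarith

/-- The lemma of du Bois-Reymond: a function with vanishing weak derivative is constant. -/
lemma exists_ae_eq_const_of_forall_integral_deriv_eq_zero {u : ℝ → ℂ}
    (hu : Integrable u cellMeasure)
    (h : ∀ φ : ℝ → ℝ, ContDiff ℝ ∞ φ → HasCompactSupport φ → tsupport φ ⊆ Ioo 0 1 →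
      ∫ y in Ioo (0 : ℝ) 1, deriv φ y • u y = 0) : ∃ c : ℂ, ∀ᵐ y ∂cellMeasure, u y = c := by
  obtain ⟨ψ, hψ, hψc, hψs, hψ1⟩ := exists_testFunction_integral_eq_one
  have hint : ∀ {η : ℝ → ℝ}, ContDiff ℝ ∞ η → HasCompactSupport η → ∀ {v : ℝ → ℂ},
      Integrable v cellMeasure → Integrable (fun y => η y • v y) cellMeasure := by
    intro η hη hηc v hv
    obtain ⟨C, hC⟩ := hη.continuous.bounded_above_of_compact_support hηc
    exact hv.bdd_smul C hη.continuous.aestronglyMeasurable (Filter.Eventually.of_forall hC)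
  set c := ∫ y in Ioo (0 : ℝ) 1, ψ y • u y with hcdef
  refine ⟨c, ?_⟩
  have hz : (fun y => u y - c) =ᵐ[cellMeasure] 0 := by
    refine ae_eq_zero_of_forall_integral_smul_eq_zero (hu.sub (integrable_const c))
      fun η hη hηc hηs => ?_
    set a := ∫ y, η y with ha
    have hiη : Integrable η := hη.continuous.integrable_of_hasCompactSupport hηc
    have hiψ : Integrable ψ := hψ.continuous.integrable_of_hasCompactSupport hψc
    -- Subtracting `a ψ` makes the mean of `η` vanish, so the difference is the derivative of a test
    -- function. Then `∫ η u = a ∫ ψ u`, which is why `c` is `∫ ψ u`.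
    obtain ⟨φ, hφ, hφc, hφs, hφ'⟩ := exists_deriv_eq_of_integral_eq_zero
      (χ := fun y => η y - a * ψ y) (hη.sub (contDiff_const.mul hψ))
      (hηc.sub (hψc.mul_left (f := fun _ => a)))
      ((tsupport_sub _ _).trans (union_subset hηs ((tsupport_mul_subset_right).trans hψs)))
      (by rw [integral_sub hiη (hiψ.const_mul a), integral_const_mul, hψ1, mul_one, sub_self])
    have h1 := h φ hφ hφc hφs
    have hηI : ∫ y in Ioo (0 : ℝ) 1, η y = a :=
      setIntegral_eq_integral_of_forall_compl_eq_zero fun y hy =>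
        image_eq_zero_of_notMem_tsupport fun hy' => hy (hηs hy')
    have h2 : ∫ y in Ioo (0 : ℝ) 1, deriv φ y • u y =
        (∫ y in Ioo (0 : ℝ) 1, η y • u y) - a • c := by
      have hi : Integrable (fun y => a • ψ y • u y) cellMeasure := (hint hψ hψc hu).smul a
      rw [hcdef, ← integral_smul, ← integral_sub (hint hη hηc hu) hi, hφ']
      refine integral_congr_ae (Filter.Eventually.of_forall fun y => ?_)
      simp only [sub_smul, mul_smul]
    have h3 : ∫ y in Ioo (0 : ℝ) 1, η y • (u y - c) =
        (∫ y in Ioo (0 : ℝ) 1, η y • u y) - a • c := by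
      rw [← hηI, ← integral_smul_const,
        ← integral_sub (hint hη hηc hu) (hint hη hηc (integrable_const c))]
      simp only [smul_sub]
    rw [h3, ← h2, h1]
  filter_upwards [hz] with y hy
  exact sub_eq_zero.1 hy

/-- The integral over the cell as a functional on `L²`. -/
def cellIntegral : L2Cell →L[ℂ] ℂ :=
  innerSL ℂ (indicatorConstLp 2 MeasurableSet.univ (measure_ne_top cellMeasure univ) (1 : ℂ))

lemma cellIntegral_apply (g : L2Cell) : cellIntegral g = ∫ t, g t ∂cellMeasure := by
  rw [cellIntegral, innerSL_apply_apply, L2.inner_indicatorConstLp_one, Measure.restrict_univ]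

lemma integrable_L2Cell (g : L2Cell) : Integrable g cellMeasure :=
  (Lp.memLp g).integrable one_le_two

/-- Cauchy–Schwarz against the indicator of `(x, y]`; this modulus of continuity feeds
Arzelà–Ascoli. -/
lemma norm_cellPrimitive_sub_le (g : L2Cell) {x y : ℝ} (hxy : x ≤ y) :
    ‖cellPrimitive g y - cellPrimitive g x‖ ≤ √(y - x) * ‖g‖ := by
  have hi : ∀ a b, IntervalIntegrable g cellMeasure a b := fun a b =>
    (integrable_L2Cell g).intervalIntegrable
  rw [cellPrimitive, cellPrimitive, intervalIntegral.integral_interval_sub_left (hi _ _) (hi _ _),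
    intervalIntegral.integral_of_le hxy,
    ← L2.inner_indicatorConstLp_one measurableSet_Ioc (measure_ne_top _ _)]
  refine (norm_inner_le_norm _ _).trans ?_
  gcongr
  rw [norm_indicatorConstLp two_ne_zero ENNReal.ofNat_ne_top, norm_one, one_mul, Real.sqrt_eq_rpow,
    ENNReal.toReal_ofNat]
  gcongr
  rw [measureReal_def, ← ENNReal.toReal_ofReal (sub_nonneg.2 hxy), ← Real.volume_Ioc]
  exact ENNReal.toReal_mono (by simp) (Measure.restrict_apply_le _ _)

lemma norm_cellPrimitive_le (g : L2Cell) (y : ℝ) : ‖cellPrimitive g y‖ ≤ ‖g‖ := by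
  have h : ∀ s : Set ℝ, MeasurableSet s → ‖∫ t in s, g t ∂cellMeasure‖ ≤ ‖g‖ := by
    intro s hs
    rw [← L2.inner_indicatorConstLp_one hs (measure_ne_top _ _)]
    refine (norm_inner_le_norm _ _).trans (mul_le_of_le_one_left (norm_nonneg _) ?_)
    rw [norm_indicatorConstLp two_ne_zero ENNReal.ofNat_ne_top, norm_one, one_mul]
    exact Real.rpow_le_one measureReal_nonneg measureReal_le_one (by simp)
  rw [cellPrimitive, intervalIntegral.norm_intervalIntegral_eq]
  exact h _ measurableSet_uIoc

lemma cellPrimitive_add (g k : L2Cell) (y : ℝ) :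
    cellPrimitive (g + k : L2Cell) y = cellPrimitive g y + cellPrimitive k y := by
  rw [cellPrimitive, cellPrimitive, cellPrimitive, ← intervalIntegral.integral_add
    (integrable_L2Cell g).intervalIntegrable (integrable_L2Cell k).intervalIntegrable]
  refine intervalIntegral.integral_congr_ae' ?_ ?_ <;>
  · filter_upwards [Lp.coeFn_add g k] with t ht _
    exact ht

lemma cellPrimitive_smul (c : ℂ) (g : L2Cell) (y : ℝ) :
    cellPrimitive (c • g : L2Cell) y = c • cellPrimitive g y := by
  rw [cellPrimitive, cellPrimitive, ← intervalIntegral.integral_smul]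
  refine intervalIntegral.integral_congr_ae' ?_ ?_ <;>
  · filter_upwards [Lp.coeFn_smul c g] with t ht _
    exact ht

/-- The primitive as a bounded operator from `L²` to the bounded continuous functions. -/
def cellPrimitiveBCF : L2Cell →L[ℂ] BoundedContinuousFunction ℝ ℂ :=
  LinearMap.mkContinuous
    { toFun := fun g => BoundedContinuousFunction.ofNormedAddCommGroup (cellPrimitive g)
        (continuous_cellPrimitive (integrable_L2Cell g)) ‖g‖ (norm_cellPrimitive_le g)
      map_add' := fun g k => by
        ext y
        exact cellPrimitive_add g k y
      map_smul' := fun c g => by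
        ext y
        exact cellPrimitive_smul c g y } 1 fun g => by
    rw [one_mul]
    exact BoundedContinuousFunction.norm_ofNormedAddCommGroup_le _ (norm_nonneg g)
      (norm_cellPrimitive_le g)

/-- Multiplication by a bounded function on `L²`. -/
def cellMul {w : ℝ → ℝ} (hw : MemLp w ∞ cellMeasure) : L2Cell →L[ℂ] L2Cell :=
  (ContinuousLinearMap.mul ℂ ℂ).holderL cellMeasure ∞ 2 2 ((hw.ofReal (K := ℂ)).toLp _)

lemma coeFn_cellMul {w : ℝ → ℝ} (hw : MemLp w ∞ cellMeasure) (g : L2Cell) :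
    ∀ᵐ y ∂cellMeasure, cellMul hw g y = (w y : ℂ) * g y := by
  have h1 := (ContinuousLinearMap.mul ℂ ℂ).coeFn_holder (r := 2) ((hw.ofReal (K := ℂ)).toLp _) g
  filter_upwards [h1, (hw.ofReal (K := ℂ)).coeFn_toLp] with y hy1 hy2
  rw [hy2] at hy1
  exact hy1

lemma memLp_sqrt {w : ℝ → ℝ} (hw : MemLp w ∞ cellMeasure) :
    MemLp (fun y => √(w y)) ∞ cellMeasure := by
  refine ((memLp_const (1 : ℝ)).add hw.norm).mono
    (Real.continuous_sqrt.comp_aestronglyMeasurable hw.1) (Filter.Eventually.of_forall fun y => ?_)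
  rw [Real.norm_of_nonneg (Real.sqrt_nonneg _), Pi.add_apply,
    Real.norm_of_nonneg (by positivity), Real.sqrt_le_left (by positivity)]
  nlinarith [norm_nonneg (w y), Real.le_norm_self (w y)]

/-- The square root of the form `∫ w g conj(k)` of a nonnegative weight. -/
lemma inner_cellMul_sqrt {w : ℝ → ℝ} (hw : MemLp w ∞ cellMeasure)
    (hpos : ∀ᵐ y ∂cellMeasure, 0 ≤ w y) (g k : L2Cell) :
    inner ℂ (cellMul (memLp_sqrt hw) k) (cellMul (memLp_sqrt hw) g) =
      ∫ y in Ioo (0 : ℝ) 1, (w y : ℂ) * g y * conj (k y) := by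
  rw [L2.inner_def]
  refine integral_congr_ae ?_
  filter_upwards [coeFn_cellMul (memLp_sqrt hw) k, coeFn_cellMul (memLp_sqrt hw) g, hpos] with
    y h1 h2 h3
  rw [h1, h2, RCLike.inner_apply, map_mul, Complex.conj_ofReal]
  have : ((√(w y) : ℝ) : ℂ) * (√(w y) : ℝ) = w y := by
    rw [← Complex.ofReal_mul, Real.mul_self_sqrt h3]
  rw [← this]
  ring

lemma integrable_testFunction_smul {η : ℝ → ℝ} (hη : Continuous η) (hηc : HasCompactSupport η)
    {v : ℝ → ℂ} (hv : Integrable v cellMeasure) :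
    Integrable (fun y => η y • v y) cellMeasure := by
  obtain ⟨C, hC⟩ := hη.bounded_above_of_compact_support hηc
  exact hv.bdd_smul C hη.aestronglyMeasurable (Filter.Eventually.of_forall hC)

lemma setIntegral_deriv_eq_zero {φ : ℝ → ℝ} (hφ : ContDiff ℝ ∞ φ) (hs : tsupport φ ⊆ Ioo 0 1) :
    ∫ y in Ioo (0 : ℝ) 1, deriv φ y = 0 := by
  have h0 : φ 0 = 0 := image_eq_zero_of_notMem_tsupport fun h => by simpa using hs h
  have h1 : φ 1 = 0 := image_eq_zero_of_notMem_tsupport fun h => by simpa using hs h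
  have h2 : ∫ y in (0 : ℝ)..1, deriv φ y = φ 1 - φ 0 :=
    intervalIntegral.integral_deriv_eq_sub
      (fun x _ => (hφ.differentiable (by simp)).differentiableAt)
      ((hφ.continuous_deriv (by simp)).intervalIntegrable _ _)
  rwa [h0, h1, sub_zero, intervalIntegral.integral_of_le zero_le_one,
    integral_Ioc_eq_integral_Ioo] at h2

/-- A continuous function on `[0, 1]` of the form `exp(iθy) v(y)` with `v` periodic. -/
lemma exists_periodic_of_quasiperiodic {U : ℝ → ℂ} (hU : Continuous U) {θ : ℝ}
    (h : U 1 = Complex.exp (Complex.I * θ) * U 0) :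
    ∃ v : ℝ → ℂ, Continuous v ∧ Function.Periodic v 1 ∧
      ∀ y ∈ Ioo (0 : ℝ) 1, U y = Complex.exp (Complex.I * θ * y) * v y := by
  let W : ℝ → ℂ := fun y => Complex.exp (-(Complex.I * θ * y)) * U y
  have hW : Continuous W := by fun_prop
  -- The hypothesis `h` says `W 0 = W 1`, which is what continuity of the periodization at the
  -- integers requires.
  refine ⟨W ∘ Int.fract, ContinuousOn.comp_fract'' hW.continuousOn ?_, fun y => ?_, fun y hy => ?_⟩
  · simp only [W, h, Complex.ofReal_zero, Complex.ofReal_one, mul_zero, neg_zero, Complex.exp_zero,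
      one_mul, mul_one]
    rw [← mul_assoc, ← Complex.exp_add, neg_add_cancel, Complex.exp_zero, one_mul]
  · simp only [Function.comp_apply, Int.fract_add_one]
  · simp only [Function.comp_apply, Int.fract_eq_self.2 ⟨hy.1.le, hy.2⟩, W]
    rw [← mul_assoc, ← Complex.exp_add, add_neg_cancel, Complex.exp_zero, one_mul]

/-- Two continuous functions agreeing almost everywhere on the cell agree on `[0, 1]`. -/
lemma eqOn_Icc_of_ae_eq {U V : ℝ → ℂ} (hU : Continuous U) (hV : Continuous V)
    (h : ∀ᵐ y ∂cellMeasure, U y = V y) : EqOn U V (Icc 0 1) := by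
  refine Measure.eqOn_of_ae_eq (μ := volume) ?_ hU.continuousOn hV.continuousOn ?_
  · rw [← Measure.restrict_congr_set Ioo_ae_eq_Icc]
    exact h
  · rw [closure_interior_Icc zero_ne_one]

/-- A primitive vanishing almost everywhere has vanishing derivative. -/
lemma eq_zero_of_cellPrimitive_ae_eq_zero {g : L2Cell}
    (h : ∀ᵐ y ∂cellMeasure, cellPrimitive g y = 0) : g = 0 := by
  rw [Lp.eq_zero_iff_ae_eq_zero]
  refine ae_eq_zero_of_forall_integral_smul_eq_zero (integrable_L2Cell g) fun φ hφ hc hs => ?_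
  rw [← neg_eq_zero, ← integral_deriv_smul_cellPrimitive (integrable_L2Cell g) hφ hc hs]
  refine integral_eq_zero_of_ae ?_
  filter_upwards [h] with y hy
  rw [hy, smul_zero, Pi.zero_apply]

/-! ### The space `H¹_θ`: description, closedness, compactness and density. -/

namespace PeriodicCell

variable (M : PeriodicCell)

instance : IsFiniteMeasure M.weightedMeasure :=
  isFiniteMeasure_withDensity_ofReal (M.ρ_adm.1.integrable le_top).2

lemma weightedMeasure_absolutelyContinuous : M.weightedMeasure ≪ cellMeasure :=
  withDensity_absolutelyContinuous _ _

lemma ext_cell {u v : M.L2} (h : ∀ᵐ y ∂cellMeasure, u y = v y) : u = v :=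
  Lp.ext (M.weightedMeasure_absolutelyContinuous.ae_le h)

/-- The inclusion of bounded continuous functions into `L²_ρ(Y)`. -/
def ofBCF : BoundedContinuousFunction ℝ ℂ →L[ℂ] M.L2 :=
  BoundedContinuousFunction.toLp 2 M.weightedMeasure ℂ

lemma coeFn_ofBCF (f : BoundedContinuousFunction ℝ ℂ) : ∀ᵐ y ∂cellMeasure, M.ofBCF f y = f y :=
  M.cellMeasure_absolutelyContinuous.ae_le (BoundedContinuousFunction.coeFn_toLp _ _ ℂ f)

/-- The primitive as a bounded operator into `L²_ρ(Y)`. -/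
def primitive : L2Cell →L[ℂ] M.L2 := M.ofBCF ∘L cellPrimitiveBCF

lemma coeFn_primitive (g : L2Cell) : ∀ᵐ y ∂cellMeasure, M.primitive g y = cellPrimitive g y :=
  M.coeFn_ofBCF _

lemma primitive_injective : Function.Injective M.primitive := by
  rw [injective_iff_map_eq_zero]
  intro g hg
  refine eq_zero_of_cellPrimitive_ae_eq_zero ?_
  have h0 : ((0 : M.L2) : ℝ → ℂ) =ᵐ[cellMeasure] 0 :=
    M.cellMeasure_absolutelyContinuous.ae_le (Lp.coeFn_zero ℂ 2 M.weightedMeasure)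
  have h1 := M.coeFn_primitive g
  rw [hg] at h1
  filter_upwards [h0, h1] with y hy0 hy1
  rw [← hy1, hy0, Pi.zero_apply]

/-- The constant function `1`. -/
def one : M.L2 := M.ofBCF (BoundedContinuousFunction.const ℝ 1)

lemma coeFn_one : ∀ᵐ y ∂cellMeasure, M.one y = 1 := M.coeFn_ofBCF _

lemma coeFn_smul_one_add (c : ℂ) (g : L2Cell) :
    ∀ᵐ y ∂cellMeasure, (c • M.one + M.primitive g) y = c + cellPrimitive g y := by
  filter_upwards [M.coeFn_one, M.coeFn_primitive g,
    M.cellMeasure_absolutelyContinuous.ae_le (Lp.coeFn_add (c • M.one) (M.primitive g)),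
    M.cellMeasure_absolutelyContinuous.ae_le (Lp.coeFn_smul c M.one)] with y h1 h2 h3 h4
  rw [h3, Pi.add_apply, h4, Pi.smul_apply, h1, h2, smul_eq_mul, mul_one]

lemma integrable_cell (u : M.L2) : Integrable u cellMeasure :=
  (M.memLp_cell u).integrable one_le_two

/-- A function in `H¹` is the sum of a constant and the primitive of its derivative; it is
quasiperiodic if and only if its boundary values are related by the factor `exp(iθ)`. -/
lemma mem_H1theta_iff {θ : ℝ} {p : M.L2 × L2Cell} : p ∈ M.H1theta θ ↔
    ∃ c : ℂ, p.1 = c • M.one + M.primitive p.2 ∧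
      c + cellIntegral p.2 = Complex.exp (Complex.I * θ) * c := by
  obtain ⟨u, g⟩ := p
  change HasWeakDerivOnCell u g ∧ IsQuasiperiodic θ u ↔ _
  have hgi := integrable_L2Cell g
  have hcont := continuous_cellPrimitive hgi
  have hPi : Integrable (cellPrimitive g) cellMeasure :=
    (M.integrable_cell (M.primitive g)).congr (M.coeFn_primitive g)
  constructor
  · rintro ⟨hw, v, hv, hvp, hvu⟩
    -- The difference of `u` and the primitive of `g` has zero weak derivative, hence is constant.
    obtain ⟨c, hc⟩ := exists_ae_eq_const_of_forall_integral_deriv_eq_zero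
      (u := fun y => u y - cellPrimitive g y) ((M.integrable_cell u).sub hPi)
      (fun φ hφ hφc hφs => by
        have hφ'c := hφ.continuous_deriv (by simp)
        simp only [smul_sub]
        rw [integral_sub (integrable_testFunction_smul hφ'c hφc.deriv (M.integrable_cell u))
          (integrable_testFunction_smul hφ'c hφc.deriv hPi), hw φ hφ hφc hφs,
          integral_deriv_smul_cellPrimitive hgi hφ hφc hφs, sub_self])
    have hue : ∀ᵐ y ∂cellMeasure, c + cellPrimitive g y = u y := by
      filter_upwards [hc] with y hy
      rw [← hy, sub_add_cancel]
    refine ⟨c, M.ext_cell ?_, ?_⟩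
    · filter_upwards [hue, M.coeFn_smul_one_add c g] with y h1 h2
      rw [h2, h1]
    -- Both sides are continuous, so the almost everywhere equality extends to the endpoints, where
    -- the boundary condition is read off.
    · have hEq : EqOn (fun y : ℝ => c + cellPrimitive g y)
          (fun y : ℝ => Complex.exp (Complex.I * θ * y) * v y) (Icc 0 1) := by
        refine eqOn_Icc_of_ae_eq (by fun_prop) (by fun_prop) ?_
        filter_upwards [hue, hvu] with y h1 h2
        rw [h1, h2]
      have e0 := hEq (left_mem_Icc.2 zero_le_one)
      have e1 := hEq (right_mem_Icc.2 zero_le_one)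
      have ev : v 1 = v 0 := by simpa using hvp 0
      simp only [cellPrimitive_zero, cellPrimitive_one, Complex.ofReal_zero, Complex.ofReal_one,
        mul_zero, Complex.exp_zero, one_mul, mul_one, add_zero, ev] at e0 e1
      rw [cellIntegral_apply, e1, e0]
  · rintro ⟨c, hu, hc⟩
    have hue : ∀ᵐ y ∂cellMeasure, u y = c + cellPrimitive g y := by
      have := M.coeFn_smul_one_add c g
      rwa [← hu] at this
    refine ⟨fun φ hφ hφc hφs => ?_, ?_⟩
    · have hφ'c := hφ.continuous_deriv (by simp)
      have e : ∫ y in Ioo (0 : ℝ) 1, deriv φ y • u y =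
          ∫ y in Ioo (0 : ℝ) 1, (deriv φ y • c + deriv φ y • cellPrimitive g y) := by
        refine integral_congr_ae ?_
        filter_upwards [hue] with y hy
        rw [hy, smul_add]
      rw [e, integral_add (integrable_testFunction_smul hφ'c hφc.deriv (integrable_const c))
          (integrable_testFunction_smul hφ'c hφc.deriv hPi),
        integral_deriv_smul_cellPrimitive hgi hφ hφc hφs, integral_smul_const,
        setIntegral_deriv_eq_zero hφ hφs, zero_smul, zero_add]
    · obtain ⟨v, hv, hvp, hvU⟩ := exists_periodic_of_quasiperiodic
        (U := fun y => c + cellPrimitive g y) (by fun_prop) (θ := θ) (by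
          rw [cellPrimitive_one, cellPrimitive_zero, add_zero, ← cellIntegral_apply]
          exact hc)
      refine ⟨v, hv, hvp, ?_⟩
      filter_upwards [hue, ae_restrict_mem measurableSet_Ioo] with y h1 h2
      rw [h1]
      exact hvU y h2

/-- Such a primitive vanishes at both endpoints, so it is quasiperiodic for every `θ` at once. All
uniformity in `θ` rests on this. -/
lemma primitive_mem_H1theta (θ : ℝ) {g : L2Cell} (hg : cellIntegral g = 0) :
    (M.primitive g, g) ∈ M.H1theta θ :=
  M.mem_H1theta_iff.2 ⟨0, by simp, by simp [hg]⟩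

lemma one_ne_zero : M.one ≠ 0 := by
  intro h
  have h0 : ((0 : M.L2) : ℝ → ℂ) =ᵐ[cellMeasure] 0 :=
    M.cellMeasure_absolutelyContinuous.ae_le (Lp.coeFn_zero ℂ 2 M.weightedMeasure)
  have h1 := M.coeFn_one
  rw [h] at h1
  obtain ⟨y, hy0, hy1⟩ := (h0.and h1).exists
  rw [hy0] at hy1
  exact zero_ne_one hy1

/-- The normalized coefficient of the constant function `1`. -/
def meanValue : M.L2 →L[ℂ] ℂ := (inner ℂ M.one M.one)⁻¹ • innerSL ℂ M.one

lemma meanValue_one : M.meanValue M.one = 1 :=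
  inv_mul_cancel₀ (inner_self_ne_zero.2 M.one_ne_zero)

/-- The constant `c` is recovered by a bounded functional of the pair, so membership becomes two
continuous equations. -/
lemma mem_H1theta_iff_meanValue {θ : ℝ} {p : M.L2 × L2Cell} : p ∈ M.H1theta θ ↔
    p.1 = M.meanValue (p.1 - M.primitive p.2) • M.one + M.primitive p.2 ∧
      M.meanValue (p.1 - M.primitive p.2) + cellIntegral p.2 =
        Complex.exp (Complex.I * θ) * M.meanValue (p.1 - M.primitive p.2) := by
  rw [M.mem_H1theta_iff]
  constructor
  · rintro ⟨c, h1, h2⟩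
    have : M.meanValue (p.1 - M.primitive p.2) = c := by
      rw [h1, add_sub_cancel_right, map_smul, M.meanValue_one, smul_eq_mul, mul_one]
    rw [this]
    exact ⟨h1, h2⟩
  · exact fun h => ⟨_, h⟩

lemma isClosed_H1theta (θ : ℝ) : IsClosed (M.H1theta θ : Set (M.L2 × L2Cell)) := by
  have : (M.H1theta θ : Set (M.L2 × L2Cell)) =
      {p | p.1 = M.meanValue (p.1 - M.primitive p.2) • M.one + M.primitive p.2} ∩
      {p | M.meanValue (p.1 - M.primitive p.2) + cellIntegral p.2 =
        Complex.exp (Complex.I * θ) * M.meanValue (p.1 - M.primitive p.2)} := by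
    ext p
    exact M.mem_H1theta_iff_meanValue
  rw [this]
  exact (isClosed_eq (by fun_prop) (by fun_prop)).inter (isClosed_eq (by fun_prop) (by fun_prop))

/-- The primitive is a compact operator. -/
lemma isCompactOperator_primitive : IsCompactOperator M.primitive := by
  -- Arzelà–Ascoli needs a compact domain, so primitives are restricted to `[0, 1]`; `Φ` returns to
  -- `L²_ρ` by clamping the argument.
  let Φ : BoundedContinuousFunction (Icc (0 : ℝ) 1) ℂ → M.L2 := fun f =>
    M.ofBCF (f.compContinuous ⟨projIcc 0 1 zero_le_one, continuous_projIcc⟩)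
  have hΦ : Continuous Φ :=
    M.ofBCF.continuous.comp (BoundedContinuousFunction.continuous_compContinuous _)
  let r : L2Cell → BoundedContinuousFunction (Icc (0 : ℝ) 1) ℂ := fun g =>
    (cellPrimitiveBCF g).compContinuous ⟨Subtype.val, continuous_subtype_val⟩
  have hr : ∀ g (y : Icc (0 : ℝ) 1), r g y = cellPrimitive g y := fun g y => rfl
  have hΦr : ∀ g, Φ (r g) = M.primitive g := by
    intro g
    refine M.ext_cell ?_
    filter_upwards [M.coeFn_primitive g, M.coeFn_ofBCF ((r g).compContinuous
      ⟨projIcc 0 1 zero_le_one, continuous_projIcc⟩), ae_restrict_mem measurableSet_Ioo]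
      with y h1 h2 h3
    rw [h1, h2]
    change cellPrimitive g (projIcc 0 1 zero_le_one y : ℝ) = _
    rw [projIcc_of_mem _ (Ioo_subset_Icc_self h3)]
  let A : Set (BoundedContinuousFunction (Icc (0 : ℝ) 1) ℂ) := r '' Metric.closedBall 0 1
  have hA : IsCompact (closure A) := by
    refine BoundedContinuousFunction.arzela_ascoli (Metric.closedBall (0 : ℂ) 1)
      (isCompact_closedBall _ _) A ?_ ?_
    · rintro _ y ⟨g, hg, rfl⟩
      rw [mem_closedBall_zero_iff] at hg ⊢
      exact (norm_cellPrimitive_le g y).trans hg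
    · refine Metric.equicontinuous_of_continuity_modulus (fun t => √t) ?_ _ ?_
      · simpa using Real.continuous_sqrt.tendsto 0
      · rintro x y ⟨_, g, hg, rfl⟩
        rw [mem_closedBall_zero_iff] at hg
        change dist (cellPrimitive g x) (cellPrimitive g y) ≤ √(dist (x : ℝ) (y : ℝ))
        have key : ∀ a b : ℝ, a ≤ b →
            dist (cellPrimitive g a) (cellPrimitive g b) ≤ √(dist a b) := by
          intro a b hab
          rw [dist_comm, dist_eq_norm, dist_comm, Real.dist_eq, abs_of_nonneg (sub_nonneg.2 hab)]
          exact (norm_cellPrimitive_sub_le g hab).trans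
            (mul_le_of_le_one_right (Real.sqrt_nonneg _) hg)
        rcases le_total (x : ℝ) y with h | h
        · exact key _ _ h
        · rw [dist_comm, dist_comm (x : ℝ)]
          exact key _ _ h
  refine ⟨Φ '' closure A, hA.image hΦ, ?_⟩
  filter_upwards [Metric.closedBall_mem_nhds (0 : L2Cell) one_pos] with g hg
  exact ⟨r g, subset_closure ⟨g, hg, rfl⟩, hΦr g⟩

/-- Weak solutions in `H¹_θ` depend compactly on the data. -/
lemma isCompactOperator_of_mem_H1theta {θ : ℝ} {R : M.L2 →L[ℂ] M.L2} {Γ : M.L2 →L[ℂ] L2Cell}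
    (h : ∀ f, (R f, Γ f) ∈ M.H1theta θ) : IsCompactOperator R := by
  -- `R` is the sum of a rank-one operator and the compact primitive composed with `Γ`.
  let c : M.L2 →L[ℂ] ℂ := M.meanValue ∘L (R - M.primitive ∘L Γ)
  have h1 : IsCompactOperator (c.smulRight M.one) := by
    have : IsCompactOperator (ContinuousLinearMap.toSpanSingleton ℂ M.one) :=
      isCompactOperator_of_locallyCompactSpace_rng _
    exact this.comp_clm c
  have h2 : IsCompactOperator (M.primitive ∘L Γ) := M.isCompactOperator_primitive.comp_clm Γ
  have h3 : (R : M.L2 → M.L2) = c.smulRight M.one + M.primitive ∘L Γ := by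
    funext f
    exact (M.mem_H1theta_iff_meanValue.1 (h f)).1
  rw [h3]
  exact h1.add h2

/-- Integrals against the density. -/
lemma inner_eq_integral (u f : M.L2) :
    inner ℂ u f = ∫ y in Ioo (0 : ℝ) 1, (M.ρ y : ℂ) * f y * conj (u y) := by
  rw [L2.inner_def]
  refine (integral_withDensity_eq_integral_toReal_smul₀ M.aemeasurable_rho
    (Filter.Eventually.of_forall fun y => ENNReal.ofReal_lt_top) _).trans ?_
  refine integral_congr_ae ?_
  filter_upwards [M.ρ_adm.2.2] with y hy
  rw [ENNReal.toReal_ofReal hy.le, RCLike.inner_apply, Complex.real_smul, mul_assoc]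

/-- `H¹_θ` is dense in `L²_ρ(Y)`. -/
lemma formClosure_H1theta (θ : ℝ) : M.formClosure (M.H1theta θ) = ⊤ := by
  rw [formClosure, Submodule.topologicalClosure_eq_top_iff, Submodule.eq_bot_iff]
  intro f hf
  rw [Submodule.mem_orthogonal] at hf
  have hρf : Integrable (fun y => (M.ρ y : ℂ) * f y) cellMeasure := by
    have h1 : MemLp (fun y => (M.ρ y : ℂ)) ∞ cellMeasure := M.ρ_adm.1.ofReal
    have h2 : MemLp (fun y => (M.ρ y : ℂ) * f y) 2 cellMeasure := (M.memLp_cell f).mul h1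
    exact h2.integrable one_le_two
  have hz : (fun y => (M.ρ y : ℂ) * f y) =ᵐ[cellMeasure] 0 := by
    refine ae_eq_zero_of_forall_integral_smul_eq_zero hρf fun φ hφ hc hs => ?_
    have hφ' : Continuous (deriv φ) := hφ.continuous_deriv (by simp)
    have hmem : MemLp (fun y => ((deriv φ y : ℝ) : ℂ)) 2 cellMeasure :=
      ((hφ'.memLp_of_hasCompactSupport hc.deriv).restrict _).ofReal
    -- The test function `φ` is itself in the form domain, as the primitive of the mean-free `φ'`;
    -- thus `ρ f` annihilates all test functions.
    set g : L2Cell := hmem.toLp _ with hg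
    have hgae := hmem.coeFn_toLp
    have hgint : cellIntegral g = 0 := by
      rw [cellIntegral_apply, integral_congr_ae hgae, integral_complex_ofReal,
        setIntegral_deriv_eq_zero hφ hs, Complex.ofReal_zero]
    have hprim : ∀ y ∈ Ioo (0 : ℝ) 1, cellPrimitive g y = φ y := by
      intro y hy
      have h0 : φ 0 = 0 := image_eq_zero_of_notMem_tsupport fun h => by simpa using hs h
      have e1 : cellPrimitive g y = ∫ t in Iic y, ((deriv φ t : ℝ) : ℂ) ∂cellMeasure := by
        rw [cellPrimitive_eq_setIntegral _ hy.1.le]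
        exact integral_congr_ae (ae_restrict_of_ae hgae)
      have e2 : ∫ t in (0 : ℝ)..y, deriv φ t = φ y - φ 0 :=
        intervalIntegral.integral_deriv_eq_sub
          (fun x _ => (hφ.differentiable (by simp)).differentiableAt)
          (hφ'.intervalIntegrable _ _)
      rw [e1, integral_complex_ofReal, cellMeasure, Measure.restrict_restrict measurableSet_Iic]
      rw [h0, sub_zero, intervalIntegral.integral_of_le hy.1.le] at e2
      rw [← e2]
      congr 3
      ext t
      simp only [mem_inter_iff, mem_Ioc, mem_Iic, mem_Ioo]
      exact ⟨fun h => ⟨h.2.1, h.1⟩, fun h => ⟨h.2, h.1, h.2.trans_lt hy.2⟩⟩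
    have h1 := hf _ ⟨_, M.primitive_mem_H1theta θ hgint, rfl⟩
    rw [LinearMap.fst_apply, M.inner_eq_integral] at h1
    rw [← h1]
    refine integral_congr_ae ?_
    filter_upwards [M.coeFn_primitive g, ae_restrict_mem measurableSet_Ioo] with y hy hy'
    rw [hy, hprim y hy', Complex.conj_ofReal, Complex.real_smul, mul_comm]
  refine M.ext_cell ?_
  have h0 : ((0 : M.L2) : ℝ → ℂ) =ᵐ[cellMeasure] 0 :=
    M.cellMeasure_absolutelyContinuous.ae_le (Lp.coeFn_zero ℂ 2 M.weightedMeasure)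
  filter_upwards [hz, h0, M.ρ_adm.2.2] with y h1 h2 h3
  rw [h2]
  have h3' : (M.ρ y : ℂ) ≠ 0 := Complex.ofReal_ne_zero.2 h3.ne'
  exact (mul_eq_zero.1 h1).resolve_left h3'

end PeriodicCell

/-! ### Coefficients, coercivity and the correction into `V_θ`. -/

/-- With `C` the essential bound of `w⁻¹`, one has `1 ≤ √C √w`; the extra `1` in the constant makes
it positive without excluding `C = 0`. -/
lemma IsAdmissibleWeight.exists_one_le_mul_sqrt {s : Set ℝ} {w : ℝ → ℝ}
    (hw : IsAdmissibleWeight s w) :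
    ∃ B : ℝ, 0 < B ∧ ∀ᵐ y ∂(volume.restrict s), 1 ≤ B * √(w y) := by
  set C := (eLpNorm (fun y => (w y)⁻¹) ∞ (volume.restrict s)).toReal with hC
  have hC0 : 0 ≤ C := ENNReal.toReal_nonneg
  refine ⟨√C + 1, by positivity, ?_⟩
  have h := ae_le_eLpNormEssSup (f := fun y => (w y)⁻¹) (μ := volume.restrict s)
  rw [← eLpNorm_exponent_top] at h
  filter_upwards [h, hw.2.2] with y h1 h2
  have h3 : (w y)⁻¹ ≤ C := by
    have := ENNReal.toReal_mono hw.2.1.2.ne h1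
    rwa [toReal_enorm, Real.norm_of_nonneg (inv_nonneg.2 h2.le)] at this
  have h4 : 1 ≤ C * w y := by
    have := mul_le_mul_of_nonneg_right h3 h2.le
    rwa [inv_mul_cancel₀ h2.ne'] at this
  have h5 : 1 ≤ √C * √(w y) := by
    rw [← Real.sqrt_mul hC0]
    exact Real.one_le_sqrt.2 h4
  nlinarith [Real.sqrt_nonneg (w y)]

namespace PeriodicCell

variable (M : PeriodicCell)

/-- A property holds almost everywhere on `Y` if it does on `Y₀` and on `Y₁`. -/
lemma ae_cell_of_ae {p : ℝ → Prop} (h₀ : ∀ᵐ y ∂(volume.restrict (Ioo 0 M.h)), y ∈ Ioo 0 M.h → p y)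
    (h₁ : ∀ᵐ y ∂(volume.restrict (Ioo M.h 1)), y ∈ Ioo M.h 1 → p y) : ∀ᵐ y ∂cellMeasure, p y := by
  rw [ae_restrict_iff' measurableSet_Ioo] at h₀ h₁ ⊢
  filter_upwards [h₀, h₁, Measure.ae_ne volume M.h] with y a b c hy
  rcases lt_or_gt_of_ne c with h | h
  · exact a ⟨hy.1, h⟩ ⟨hy.1, h⟩
  · exact b ⟨h, hy.2⟩ ⟨h, hy.2⟩

lemma softCoeff_of_mem {y : ℝ} (hy : y ∈ Ioo 0 M.h) : M.softCoeff y = M.a₀ y :=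
  indicator_of_mem hy _

lemma softCoeff_of_mem' {y : ℝ} (hy : y ∈ Ioo M.h 1) : M.softCoeff y = 0 :=
  indicator_of_notMem (fun h => lt_asymm h.2 hy.1) _

lemma coeff_of_mem {ε y : ℝ} (hy : y ∈ Ioo 0 M.h) : M.coeff ε y = M.a₀ y := by
  rw [coeff, indicator_of_mem hy, indicator_of_notMem (fun h => lt_asymm hy.2 h.1), mul_zero,
    add_zero]

lemma coeff_of_mem' {ε y : ℝ} (hy : y ∈ Ioo M.h 1) : M.coeff ε y = (ε ^ 2)⁻¹ * M.a₁ y := by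
  rw [coeff, indicator_of_mem hy, indicator_of_notMem (fun h => lt_asymm h.2 hy.1), zero_add]

lemma softCoeff_nonneg : ∀ᵐ y ∂cellMeasure, 0 ≤ M.softCoeff y := by
  refine M.ae_cell_of_ae ?_ ?_
  · filter_upwards [M.a₀_adm.2.2] with y h hy
    rw [M.softCoeff_of_mem hy]
    exact h.le
  · exact Filter.Eventually.of_forall fun y hy => (M.softCoeff_of_mem' hy).ge

lemma coeff_nonneg (ε : ℝ) : ∀ᵐ y ∂cellMeasure, 0 ≤ M.coeff ε y := by
  refine M.ae_cell_of_ae ?_ ?_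
  · filter_upwards [M.a₀_adm.2.2] with y h hy
    rw [M.coeff_of_mem hy]
    exact h.le
  · filter_upwards [M.a₁_adm.2.2] with y h hy
    rw [M.coeff_of_mem' hy]
    positivity

/-- Multiplication by the square root of `a₀ + ε⁻² a₁`. -/
def sqrtCoeff (ε : ℝ) : L2Cell →L[ℂ] L2Cell := cellMul (memLp_sqrt (M.memLp_coeff ε))

/-- Multiplication by the square root of `a₀`. -/
def sqrtSoft : L2Cell →L[ℂ] L2Cell := cellMul (memLp_sqrt M.memLp_softCoeff)

lemma memLp_indicator_hard : MemLp ((Ioo M.h 1).indicator fun _ => (1 : ℝ)) ∞ cellMeasure :=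
  memLp_indicator_const _ measurableSet_Ioo _ (Or.inr (measure_ne_top _ _))

/-- Restriction to `Y₁`. -/
def hardPart : L2Cell →L[ℂ] L2Cell := cellMul M.memLp_indicator_hard

lemma coeFn_hardPart (g : L2Cell) :
    ∀ᵐ y ∂cellMeasure, M.hardPart g y = (Ioo M.h 1).indicator g y := by
  filter_upwards [coeFn_cellMul M.memLp_indicator_hard g] with y hy
  refine hy.trans ?_
  by_cases h : y ∈ Ioo M.h 1 <;> simp [h]

lemma hardPart_eq_zero_iff (g : L2Cell) :
    M.hardPart g = 0 ↔ ∀ᵐ y ∂cellMeasure, y ∈ Ioo M.h 1 → g y = 0 := by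
  rw [Lp.eq_zero_iff_ae_eq_zero]
  constructor
  · intro h
    filter_upwards [h, M.coeFn_hardPart g] with y h1 h2 hy
    rw [h1, indicator_of_mem hy] at h2
    exact h2.symm
  · intro h
    filter_upwards [h, M.coeFn_hardPart g] with y h1 h2
    rw [h2, Pi.zero_apply, indicator_apply_eq_zero]
    exact h1

lemma mem_Vtheta_iff {θ : ℝ} {p : M.L2 × L2Cell} :
    p ∈ M.Vtheta θ ↔ p ∈ M.H1theta θ ∧ M.hardPart p.2 = 0 := by
  rw [hardPart_eq_zero_iff]
  rfl

lemma Vtheta_le_H1theta (θ : ℝ) : M.Vtheta θ ≤ M.H1theta θ := fun _ hp => hp.1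

lemma isClosed_Vtheta (θ : ℝ) : IsClosed (M.Vtheta θ : Set (M.L2 × L2Cell)) := by
  have : (M.Vtheta θ : Set (M.L2 × L2Cell)) =
      (M.H1theta θ : Set (M.L2 × L2Cell)) ∩ {p | M.hardPart p.2 = 0} := by
    ext p
    exact M.mem_Vtheta_iff
  rw [this]
  exact (M.isClosed_H1theta θ).inter (isClosed_eq (by fun_prop) (by fun_prop))

lemma inner_sqrtCoeff_eq_integral (ε : ℝ) (g k : L2Cell) :
    inner ℂ (M.sqrtCoeff ε k) (M.sqrtCoeff ε g) =
      ∫ y in Ioo (0 : ℝ) 1, (M.coeff ε y : ℂ) * g y * conj (k y) :=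
  inner_cellMul_sqrt (M.memLp_coeff ε) (M.coeff_nonneg ε) g k

lemma inner_sqrtSoft_eq_integral (g k : L2Cell) :
    inner ℂ (M.sqrtSoft k) (M.sqrtSoft g) =
      ∫ y in Ioo (0 : ℝ) 1, (M.softCoeff y : ℂ) * g y * conj (k y) :=
  inner_cellMul_sqrt M.memLp_softCoeff M.softCoeff_nonneg g k

/-- On functions vanishing on `Y₁` the penalized form does not depend on `ε`. -/
lemma inner_sqrtCoeff {g : L2Cell} (hg : M.hardPart g = 0) (ε : ℝ) (k : L2Cell) :
    inner ℂ (M.sqrtCoeff ε g) (M.sqrtCoeff ε k) = inner ℂ (M.sqrtSoft g) (M.sqrtSoft k) := by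
  rw [inner_sqrtCoeff_eq_integral, inner_sqrtSoft_eq_integral]
  refine integral_congr_ae ?_
  have h := (M.hardPart_eq_zero_iff g).1 hg
  refine M.ae_cell_of_ae (Filter.Eventually.of_forall fun y hy => ?_) ?_
  · dsimp only
    rw [M.coeff_of_mem hy, M.softCoeff_of_mem hy]
  · rw [ae_restrict_iff' measurableSet_Ioo] at h ⊢
    filter_upwards [h] with y hy h1 _
    rw [hy ⟨M.h_pos.trans h1.1, h1.2⟩ h1, map_zero, mul_zero, mul_zero]

lemma norm_sqrtCoeff {g : L2Cell} (hg : M.hardPart g = 0) (ε : ℝ) :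
    ‖M.sqrtCoeff ε g‖ = ‖M.sqrtSoft g‖ := by
  rw [@norm_eq_sqrt_re_inner ℂ, @norm_eq_sqrt_re_inner ℂ, M.inner_sqrtCoeff hg]

/-- A common bound for the inverses of the coefficients. -/
lemma exists_coercivity : ∃ B : ℝ, 0 < B ∧
    (∀ ε ∈ Ioc (0 : ℝ) 1, ∀ g, ‖g‖ ≤ B * ‖M.sqrtCoeff ε g‖) ∧
    (∀ g, M.hardPart g = 0 → ‖g‖ ≤ B * ‖M.sqrtSoft g‖) ∧
    (∀ ε ∈ Ioc (0 : ℝ) 1, ∀ g, ‖M.hardPart g‖ ≤ B * ε * ‖M.sqrtCoeff ε g‖) := by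
  obtain ⟨B₀, hB₀, h₀⟩ := M.a₀_adm.exists_one_le_mul_sqrt
  obtain ⟨B₁, hB₁, h₁⟩ := M.a₁_adm.exists_one_le_mul_sqrt
  have hnorm : ∀ (w : ℝ) (z : ℂ), ‖((√w : ℝ) : ℂ) * z‖ = √w * ‖z‖ := by
    intro w z
    rw [norm_mul, Complex.norm_real, Real.norm_of_nonneg (Real.sqrt_nonneg _)]
  have hcoeff₀ : ∀ ε : ℝ, ∀ᵐ y ∂cellMeasure, y ∈ Ioo 0 M.h →
      1 ≤ max B₀ B₁ * √(M.coeff ε y) := by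
    refine fun ε => M.ae_cell_of_ae ?_ (Filter.Eventually.of_forall fun y hy hy' =>
      (lt_asymm hy.1 hy'.2).elim)
    filter_upwards [h₀] with y h hy _
    rw [M.coeff_of_mem hy]
    exact h.trans (mul_le_mul_of_nonneg_right (le_max_left _ _) (Real.sqrt_nonneg _))
  have hcoeff₁ : ∀ ε ∈ Ioc (0 : ℝ) 1, ∀ᵐ y ∂cellMeasure, y ∈ Ioo M.h 1 →
      1 ≤ max B₀ B₁ * ε * √(M.coeff ε y) := by
    refine fun ε hε => M.ae_cell_of_ae (Filter.Eventually.of_forall fun y hy hy' =>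
      (lt_asymm hy.2 hy'.1).elim) ?_
    filter_upwards [h₁] with y h hy _
    rw [M.coeff_of_mem' hy, Real.sqrt_mul (by positivity), Real.sqrt_inv, Real.sqrt_sq hε.1.le,
      mul_assoc, mul_inv_cancel_left₀ hε.1.ne']
    exact h.trans (mul_le_mul_of_nonneg_right (le_max_right _ _) (Real.sqrt_nonneg _))
  -- On `Y₁` the square root of the coefficient is `ε⁻¹ √a₁`, which yields the gain of `ε`.
  have hhalf : ∀ ε ∈ Ioc (0 : ℝ) 1, ∀ g,
      ‖M.hardPart g‖ ≤ max B₀ B₁ * ε * ‖M.sqrtCoeff ε g‖ := by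
    intro ε hε g
    refine Lp.norm_le_mul_norm_of_ae_le_mul ?_
    filter_upwards [M.coeFn_hardPart g, coeFn_cellMul (memLp_sqrt (M.memLp_coeff ε)) g,
      hcoeff₁ ε hε] with y h1 h2 h3
    rw [h1, sqrtCoeff, h2, hnorm, ← mul_assoc]
    by_cases hy : y ∈ Ioo M.h 1
    · rw [indicator_of_mem hy]
      exact le_mul_of_one_le_left (norm_nonneg _) (h3 hy)
    · rw [indicator_of_notMem hy, norm_zero]
      have := hε.1
      positivity
  have hfull : ∀ ε ∈ Ioc (0 : ℝ) 1, ∀ g, ‖g‖ ≤ max B₀ B₁ * ‖M.sqrtCoeff ε g‖ := by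
    intro ε hε g
    refine Lp.norm_le_mul_norm_of_ae_le_mul ?_
    have hcell : ∀ᵐ y ∂cellMeasure, y ∈ Ioo 0 M.h ∨ y ∈ Ioo M.h 1 :=
      M.ae_cell_of_ae (Filter.Eventually.of_forall fun y hy => Or.inl hy)
        (Filter.Eventually.of_forall fun y hy => Or.inr hy)
    filter_upwards [coeFn_cellMul (memLp_sqrt (M.memLp_coeff ε)) g, hcoeff₀ ε, hcoeff₁ ε hε, hcell]
      with y h1 h2 h3 h4
    rw [sqrtCoeff, h1, hnorm, ← mul_assoc]
    refine le_mul_of_one_le_left (norm_nonneg _) ?_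
    rcases h4 with h4 | h4
    · exact h2 h4
    · refine (h3 h4).trans (mul_le_mul_of_nonneg_right ?_ (Real.sqrt_nonneg _))
      exact mul_le_of_le_one_right (by positivity) hε.2
  refine ⟨max B₀ B₁, by positivity, hfull, fun g hg => ?_, hhalf⟩
  -- The soft bound is the full one at `ε = 1`, which is why the range of `ε` is closed on the
  -- right.
  rw [← M.norm_sqrtCoeff hg 1]
  exact hfull 1 ⟨one_pos, le_rfl⟩ g

/-- The indicator function of `Y₀`. -/
def softIndicator : L2Cell :=
  indicatorConstLp 2 (measurableSet_Ioo (a := 0) (b := M.h)) (measure_ne_top cellMeasure _) (1 : ℂ)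

lemma cellIntegral_softIndicator : cellIntegral M.softIndicator = M.h := by
  rw [cellIntegral_apply, softIndicator, integral_indicatorConstLp, measureReal_def,
    Measure.restrict_apply measurableSet_Ioo,
    inter_eq_self_of_subset_left (Ioo_subset_Ioo_right M.h_lt_one.le), Real.volume_Ioo, sub_zero,
    ENNReal.toReal_ofReal M.h_pos.le]
  simp

lemma hardPart_softIndicator : M.hardPart M.softIndicator = 0 := by
  rw [hardPart_eq_zero_iff]
  filter_upwards [indicatorConstLp_coeFn (p := 2) (hs := measurableSet_Ioo (a := 0) (b := M.h))
    (hμs := measure_ne_top cellMeasure _) (c := (1 : ℂ))] with y hy hy'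
  exact hy.trans (indicator_of_notMem (fun h => lt_asymm h.2 hy'.1) _)

lemma hardPart_hardPart (g : L2Cell) : M.hardPart (M.hardPart g) = M.hardPart g := by
  refine Lp.ext ?_
  filter_upwards [M.coeFn_hardPart (M.hardPart g), M.coeFn_hardPart g] with y h3 h4
  rw [h3]
  by_cases hy : y ∈ Ioo M.h 1
  · rw [indicator_of_mem hy]
  · rw [indicator_of_notMem hy, h4, indicator_of_notMem hy]

/-- The subtraction of a multiple of the indicator function of `Y₀` that makes the mean vanish. -/
def meanCorrection : L2Cell →L[ℂ] L2Cell :=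
  ContinuousLinearMap.id ℂ L2Cell - ((M.h : ℂ)⁻¹ • cellIntegral).smulRight M.softIndicator

lemma meanCorrection_apply (k : L2Cell) :
    M.meanCorrection k = k - ((M.h : ℂ)⁻¹ * cellIntegral k) • M.softIndicator := by
  simp only [meanCorrection, sub_apply, ContinuousLinearMap.smulRight_apply,
    ContinuousLinearMap.id_apply, smul_apply, smul_eq_mul]

lemma cellIntegral_meanCorrection (k : L2Cell) : cellIntegral (M.meanCorrection k) = 0 := by
  have hh : (M.h : ℂ) ≠ 0 := Complex.ofReal_ne_zero.2 M.h_pos.ne'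
  rw [meanCorrection_apply, map_sub, map_smul, cellIntegral_softIndicator, smul_eq_mul]
  field_simp
  ring

/-- Functions in `H¹_θ` can be corrected on `Y₀` to functions in `V_θ`, at a cost controlled by the
derivative on `Y₁`. -/
lemma sub_meanCorrection_mem_Vtheta {θ : ℝ} {p : M.L2 × L2Cell} (hp : p ∈ M.H1theta θ) :
    (p.1 - M.primitive (M.meanCorrection (M.hardPart p.2)),
      p.2 - M.meanCorrection (M.hardPart p.2)) ∈ M.Vtheta θ := by
  obtain ⟨u, g⟩ := p
  rw [M.mem_Vtheta_iff]
  constructor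
  · have h := (M.H1theta θ).sub_mem hp
      (M.primitive_mem_H1theta θ (M.cellIntegral_meanCorrection (M.hardPart g)))
    rwa [Prod.mk_sub_mk] at h
  · dsimp only
    -- The mean is compensated on `Y₀` only, so on `Y₁` the correction equals `g` and cancels it.
    rw [map_sub, meanCorrection_apply, map_sub, map_smul, hardPart_softIndicator, smul_zero,
      sub_zero, hardPart_hardPart, sub_self]

/-! ### The resolvents of the two operators and the `ε²` estimate. -/

lemma exists_isFormSolution_fibre {ε : ℝ} (hε : ε ∈ Ioo (0 : ℝ) 1) (θ : ℝ) :
    ∃ R Γ, IsFormSolution (M.H1theta θ) (M.sqrtCoeff ε) R Γ := by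
  obtain ⟨B, -, hB, -⟩ := M.exists_coercivity
  exact exists_isFormSolution (M.isClosed_H1theta θ) fun p _ => hB ε ⟨hε.1, hε.2.le⟩ p.2

lemma exists_isFormSolution_limit (θ : ℝ) :
    ∃ R Γ, IsFormSolution (M.Vtheta θ) M.sqrtSoft R Γ := by
  obtain ⟨B, -, -, hB, -⟩ := M.exists_coercivity
  exact exists_isFormSolution (M.isClosed_Vtheta θ) fun p hp => hB p.2 (M.mem_Vtheta_iff.1 hp).2

lemma isCompactResolvent_fibre {ε θ : ℝ} {R : M.L2 →L[ℂ] M.L2} {Γ : M.L2 →L[ℂ] L2Cell}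
    (h : IsFormSolution (M.H1theta θ) (M.sqrtCoeff ε) R Γ) :
    IsCompactResolvent (M.fibreOperator ε θ) ⊤ R := by
  refine h.isCompactResolvent (fun _ _ => Submodule.mem_top) (fun u f => ?_)
    (M.isCompactOperator_of_mem_H1theta h.mem)
  rw [M.fibreOperator_graph]
  change f ∈ M.formClosure (M.H1theta θ) ∧ _ ↔ _
  rw [M.formClosure_H1theta]
  simp only [inner_sqrtCoeff_eq_integral]

lemma isCompactResolvent_limit {θ : ℝ} {R : M.L2 →L[ℂ] M.L2} {Γ : M.L2 →L[ℂ] L2Cell}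
    (h : IsFormSolution (M.Vtheta θ) M.sqrtSoft R Γ) :
    IsCompactResolvent (M.limitOperator θ) (M.Vclosure θ) R := by
  refine h.isCompactResolvent (fun p hp => subset_closure ⟨p, hp, rfl⟩) (fun u f => ?_)
    (M.isCompactOperator_of_mem_H1theta fun f => (M.Vtheta_le_H1theta θ) (h.mem f))
  rw [M.limitOperator_graph]
  change f ∈ M.formClosure (M.Vtheta θ) ∧ _ ↔ _
  simp only [inner_sqrtSoft_eq_integral]

instance (θ : ℝ) : (M.Vclosure θ).HasOrthogonalProjection := by
  have : CompleteSpace (M.Vclosure θ) :=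
    (Submodule.isClosed_topologicalClosure _).completeSpace_coe
  infer_instance

/-- The resolvent estimate with rate `ε²`. -/
lemma exists_norm_resolvent_sub_le : ∃ C : ℝ, 0 < C ∧ ∀ ε ∈ Ioo (0 : ℝ) 1, ∀ θ : ℝ,
    ∀ Rε Γε R Γ, IsFormSolution (M.H1theta θ) (M.sqrtCoeff ε) Rε Γε →
      IsFormSolution (M.Vtheta θ) M.sqrtSoft R Γ →
      ∀ f : M.L2, ‖Rε f - R f‖ ≤ C * ε ^ 2 * ‖f‖ := by
  obtain ⟨B, hB, -, -, hBh⟩ := M.exists_coercivity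
  let Q := M.meanCorrection
  -- The squared operator norms measure the correction in the energy of `ε = 1`, and `B ^ 2` comes
  -- from the bound on `Y₁`; the `1` ensures positivity.
  set c := (‖M.sqrtCoeff 1 ∘L Q‖ ^ 2 + ‖M.primitive ∘L Q‖ ^ 2 + 1) * B ^ 2 with hc
  refine ⟨c, by positivity, fun ε hε θ Rε Γε R Γ hRε hR f => ?_⟩
  refine hRε.norm_sub_le hR (M.Vtheta_le_H1theta θ) (S₁ := M.sqrtCoeff 1)
    (fun v hv k => M.inner_sqrtCoeff (M.mem_Vtheta_iff.1 hv).2 ε k)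
    (fun v hv k => ?_) (fun p hp => ⟨_, M.sub_meanCorrection_mem_Vtheta hp, ?_⟩) (by positivity) f
  · rw [M.inner_sqrtCoeff (M.mem_Vtheta_iff.1 hv).2, M.inner_sqrtCoeff (M.mem_Vtheta_iff.1 hv).2]
  · dsimp only
    rw [sub_sub_cancel, sub_sub_cancel]
    set k := M.hardPart p.2
    have h1 : ‖M.sqrtCoeff 1 (Q k)‖ ≤ ‖M.sqrtCoeff 1 ∘L Q‖ * ‖k‖ :=
      (M.sqrtCoeff 1 ∘L Q).le_opNorm k
    have h2 : ‖M.primitive (Q k)‖ ≤ ‖M.primitive ∘L Q‖ * ‖k‖ := (M.primitive ∘L Q).le_opNorm k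
    have h3 : ‖k‖ ≤ B * ε * ‖M.sqrtCoeff ε p.2‖ := hBh ε ⟨hε.1, hε.2.le⟩ p.2
    calc ‖M.sqrtCoeff 1 (Q k)‖ ^ 2 + ‖M.primitive (Q k)‖ ^ 2
        ≤ (‖M.sqrtCoeff 1 ∘L Q‖ * ‖k‖) ^ 2 + (‖M.primitive ∘L Q‖ * ‖k‖) ^ 2 := by gcongr
      _ ≤ (‖M.sqrtCoeff 1 ∘L Q‖ ^ 2 + ‖M.primitive ∘L Q‖ ^ 2 + 1) * ‖k‖ ^ 2 := by
          nlinarith [sq_nonneg ‖k‖]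
      _ ≤ (‖M.sqrtCoeff 1 ∘L Q‖ ^ 2 + ‖M.primitive ∘L Q‖ ^ 2 + 1) *
            (B * ε * ‖M.sqrtCoeff ε p.2‖) ^ 2 := by gcongr
      _ = c * ε ^ 2 * ‖M.sqrtCoeff ε p.2‖ ^ 2 := by
          rw [hc]
          ring

/-! ### Test spaces common to all parameters. -/

/-- There are spaces of arbitrarily large dimension of mean-free functions supported in `Y₀`. -/
lemma exists_finrank_gt_hardPart_eq_zero (n : ℕ) : ∃ F : Submodule ℂ L2Cell,
    FiniteDimensional ℂ F ∧ n < Module.finrank ℂ F ∧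
      ∀ g ∈ F, M.hardPart g = 0 ∧ cellIntegral g = 0 := by
  -- Indicators of `N` disjoint subintervals of `Y₀` span dimension `N`; the mean-zero condition
  -- costs at most one, leaving at least `n + 1`.
  set N := n + 2 with hN
  have hNpos : (0 : ℝ) < N := by positivity
  have hh := M.h_pos
  let s : Fin N → Set ℝ := fun k => Ioo (M.h * k / N) (M.h * (k + 1) / N)
  have hs : ∀ k, MeasurableSet (s k) := fun k => measurableSet_Ioo
  have hsub : ∀ k, s k ⊆ Ioo 0 M.h := by
    intro k
    refine Ioo_subset_Ioo (by positivity) ?_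
    rw [div_le_iff₀ hNpos]
    gcongr
    exact_mod_cast k.2
  have hdisj : ∀ i j : Fin N, i < j → Disjoint (s i) (s j) := by
    intro i j hij
    rw [Set.disjoint_left]
    intro x hi hj
    have hij' : ((i : ℕ) : ℝ) + 1 ≤ (j : ℕ) := by exact_mod_cast hij
    have : M.h * ((i : ℕ) + 1) / N ≤ M.h * (j : ℕ) / N := by gcongr
    exact absurd (hi.2.trans_le this) (not_lt.2 hj.1.le)
  let e : Fin N → L2Cell := fun k =>
    indicatorConstLp 2 (hs k) (measure_ne_top cellMeasure _) (1 : ℂ)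
  have heae : ∀ k, e k =ᵐ[cellMeasure] (s k).indicator fun _ => (1 : ℂ) := fun k =>
    indicatorConstLp_coeFn (p := 2) (hs := hs k) (hμs := measure_ne_top cellMeasure _)
      (c := (1 : ℂ))
  have hinner : ∀ i j, i ≠ j → inner ℂ (e i) (e j) = 0 := by
    intro i j hij
    have hd : Disjoint (s i) (s j) := by
      rcases lt_or_gt_of_ne hij with h | h
      · exact hdisj i j h
      · exact (hdisj j i h).symm
    rw [L2.inner_indicatorConstLp_one (hs i)]
    refine integral_eq_zero_of_ae ?_
    filter_upwards [ae_restrict_of_ae (heae j), ae_restrict_mem (hs i)] with y h1 h2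
    exact h1.trans (indicator_of_notMem (Set.disjoint_left.1 hd h2) _)
  have hne : ∀ k, e k ≠ 0 := by
    intro k h0
    have h1 : cellMeasure (s k) ≠ 0 := by
      rw [Measure.restrict_apply (hs k), inter_eq_self_of_subset_left
        ((hsub k).trans (Ioo_subset_Ioo_right M.h_lt_one.le)), Real.volume_Ioo,
        Ne, ENNReal.ofReal_eq_zero, not_le, sub_pos]
      gcongr
      linarith
    have h2 : ‖e k‖ = 0 := by rw [h0, norm_zero]
    rw [norm_indicatorConstLp two_ne_zero ENNReal.ofNat_ne_top, norm_one, one_mul,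
      Real.rpow_eq_zero measureReal_nonneg (by simp), measureReal_eq_zero_iff] at h2
    exact h1 h2
  have hli : LinearIndependent ℂ e := linearIndependent_of_ne_zero_of_inner_eq_zero hne
    fun i j hij => hinner i j hij
  let L : (Fin N → ℂ) →ₗ[ℂ] L2Cell := Fintype.linearCombination ℂ e
  have hL : Function.Injective L := linearIndependent_iff_injective_fintypeLinearCombination.1 hli
  let I : (Fin N → ℂ) →ₗ[ℂ] ℂ := cellIntegral.toLinearMap ∘ₗ L
  refine ⟨(LinearMap.ker I).map L, inferInstance, ?_, ?_⟩
  · rw [← (Submodule.equivMapOfInjective L hL (LinearMap.ker I)).finrank_eq]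
    have h1 := I.finrank_range_add_finrank_ker
    have h2 : Module.finrank ℂ (LinearMap.range I) ≤ 1 := by
      simpa using (LinearMap.range I).finrank_le
    rw [Module.finrank_fin_fun] at h1
    omega
  · rintro _ ⟨c, hc, rfl⟩
    refine ⟨?_, hc⟩
    have h1 : ∀ k, M.hardPart (e k) = 0 := by
      intro k
      rw [hardPart_eq_zero_iff]
      filter_upwards [heae k] with y hy hy'
      exact hy.trans (indicator_of_notMem (fun h => lt_asymm (hsub k h).2 hy'.1) _)
    simp only [L, Fintype.linearCombination_apply, map_sum, map_smul, h1, smul_zero,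
      Finset.sum_const_zero]

/-- Test spaces for the variational characterization of the eigenvalues, common to all operators. -/
lemma exists_testSpace (n : ℕ) : ∃ (W : Submodule ℂ M.L2) (t : ℝ), n < Module.finrank ℂ W ∧ 0 < t ∧
    (∀ ε θ R Γ, IsFormSolution (M.H1theta θ) (M.sqrtCoeff ε) R Γ →
      ∀ x ∈ W, t * ‖x‖ ^ 2 ≤ (inner ℂ x (R x)).re) ∧
    (∀ θ R Γ, IsFormSolution (M.Vtheta θ) M.sqrtSoft R Γ →
      ∀ x ∈ W, t * ‖x‖ ^ 2 ≤ (inner ℂ x (R x)).re) := by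
  obtain ⟨F, hF, hFn, hF0⟩ := M.exists_finrank_gt_hardPart_eq_zero n
  let P : F →ₗ[ℂ] M.L2 := M.primitive.toLinearMap ∘ₗ F.subtype
  have hP : Function.Injective P := M.primitive_injective.comp Subtype.val_injective
  -- In finite dimension the injective primitive is bounded below, so a derivative in `F` is
  -- controlled by its primitive. This reverse inequality gives the Rayleigh bound `T`.
  obtain ⟨κ, -, hκ⟩ := P.exists_antilipschitzWith (LinearMap.ker_eq_bot.2 hP)
  have hbound : ∀ g ∈ F, ‖g‖ ≤ κ * ‖M.primitive g‖ := by
    intro g hg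
    have := hκ.le_mul_dist ⟨g, hg⟩ 0
    rw [map_zero, dist_zero_right, dist_zero_right] at this
    exact this
  set T := (‖M.sqrtSoft‖ * κ) ^ 2 + 1 with hT
  have hTpos : 0 < T := by positivity
  have henergy : ∀ g ∈ F, ‖M.sqrtSoft g‖ ^ 2 + ‖M.primitive g‖ ^ 2 ≤ T * ‖M.primitive g‖ ^ 2 := by
    intro g hg
    have h1 : ‖M.sqrtSoft g‖ ≤ ‖M.sqrtSoft‖ * κ * ‖M.primitive g‖ := by
      refine (M.sqrtSoft.le_opNorm g).trans ?_
      rw [mul_assoc]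
      exact mul_le_mul_of_nonneg_left (hbound g hg) (norm_nonneg _)
    have h2 : ‖M.sqrtSoft g‖ ^ 2 ≤ (‖M.sqrtSoft‖ * κ * ‖M.primitive g‖) ^ 2 := by gcongr
    rw [hT]
    linarith [mul_pow (‖M.sqrtSoft‖ * κ) ‖M.primitive g‖ 2]
  refine ⟨LinearMap.range P, T⁻¹, ?_, inv_pos.2 hTpos, ?_, ?_⟩
  · rwa [LinearMap.finrank_range_of_inj hP]
  · rintro ε θ R Γ h _ ⟨⟨g, hg⟩, rfl⟩
    refine h.mul_norm_sq_le (g := g) (M.primitive_mem_H1theta θ (hF0 g hg).2) hTpos ?_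
    rw [M.norm_sqrtCoeff (hF0 g hg).1]
    exact henergy g hg
  · rintro θ R Γ h _ ⟨⟨g, hg⟩, rfl⟩
    exact h.mul_norm_sq_le (g := g)
      (M.mem_Vtheta_iff.2 ⟨M.primitive_mem_H1theta θ (hF0 g hg).2, (hF0 g hg).1⟩) hTpos
      (henergy g hg)

end PeriodicCell

lemma eq_zero_of_rayleigh {H : Type*} [NormedAddCommGroup H] [InnerProductSpace ℂ H] {t : ℝ}
    (ht : 0 < t) {x y : H} (h : t * ‖x‖ ^ 2 ≤ (inner ℂ x y).re) (hy : y = 0) : x = 0 := by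
  rw [hy, inner_zero_right, Complex.zero_re] at h
  by_contra hx
  have : 0 < ‖x‖ := norm_pos_iff.2 hx
  exact absurd h (not_le.2 (by positivity))

end

/-! ### Conclusion. -/

theorem theorem2p1 (M : PeriodicCell) :
    -- uniform norm-resolvent convergence at rate `ε²`
    (∃ C : ℝ, 0 < C ∧ ∀ ε ∈ Set.Ioo (0 : ℝ) 1, ∀ θ ∈ Set.Ico (0 : ℝ) (2 * Real.pi),
      ∃ Rε R : M.L2 →L[ℂ] M.L2,
        IsResolventAddOne (M.fibreOperator ε θ) ⊤ Rε ∧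
        IsResolventAddOne (M.limitOperator θ) (M.Vclosure θ) R ∧
        ∀ f : M.L2, ‖Rε f - R f‖ ≤ C * ε ^ 2 * ‖f‖) ∧
    -- the eigenvalue sequences exist
    (∀ ε ∈ Set.Ioo (0 : ℝ) 1, ∀ θ ∈ Set.Ico (0 : ℝ) (2 * Real.pi),
      ∃ ev : ℕ → ℝ, IsEigenvalueSequence (M.fibreOperator ε θ) ev) ∧
    (∀ θ ∈ Set.Ico (0 : ℝ) (2 * Real.pi),
      ∃ ev : ℕ → ℝ, IsEigenvalueSequence (M.limitOperator θ) ev) ∧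
    -- uniform convergence of the band functions at rate `ε²`
    (∀ n : ℕ, ∃ c : ℝ, 0 < c ∧ ∀ ε ∈ Set.Ioo (0 : ℝ) 1, ∀ θ ∈ Set.Ico (0 : ℝ) (2 * Real.pi),
      ∀ evε ev : ℕ → ℝ, IsEigenvalueSequence (M.fibreOperator ε θ) evε →
        IsEigenvalueSequence (M.limitOperator θ) ev → |evε n - ev n| ≤ c * ε ^ 2) := by
  obtain ⟨C, hC, hest⟩ := M.exists_norm_resolvent_sub_le
  refine ⟨⟨C, hC, fun ε hε θ _ => ?_⟩, fun ε hε θ _ => ?_, fun θ _ => ?_, fun n => ?_⟩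
  · obtain ⟨Rε, Γε, hRε⟩ := M.exists_isFormSolution_fibre hε θ
    obtain ⟨R, Γ, hR⟩ := M.exists_isFormSolution_limit θ
    exact ⟨Rε, R, (M.isCompactResolvent_fibre hRε).toIsResolventAddOne,
      (M.isCompactResolvent_limit hR).toIsResolventAddOne, hest ε hε θ Rε Γε R Γ hRε hR⟩
  · obtain ⟨R, Γ, hR⟩ := M.exists_isFormSolution_fibre hε θ
    refine (M.isCompactResolvent_fibre hR).exists_isEigenvalueSequence fun n => ?_
    obtain ⟨W, t, hW, ht, h, -⟩ := M.exists_testSpace n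
    exact ⟨W, hW, fun x hx => eq_zero_of_rayleigh ht (h ε θ R Γ hR x hx)⟩
  · obtain ⟨R, Γ, hR⟩ := M.exists_isFormSolution_limit θ
    refine (M.isCompactResolvent_limit hR).exists_isEigenvalueSequence fun n => ?_
    obtain ⟨W, t, hW, ht, -, h⟩ := M.exists_testSpace n
    exact ⟨W, hW, fun x hx => eq_zero_of_rayleigh ht (h θ R Γ hR x hx)⟩
  · obtain ⟨W, t, hW, ht, hε', h'⟩ := M.exists_testSpace n
    -- `C ε²` is the distance of the resolvents, and `t` bounds both resolvent eigenvalues below for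
    -- all `ε` and `θ`.
    refine ⟨C / t ^ 2, by positivity, fun ε hε θ _ evε ev hevε hev => ?_⟩
    obtain ⟨Rε, Γε, hRε⟩ := M.exists_isFormSolution_fibre hε θ
    obtain ⟨R, Γ, hR⟩ := M.exists_isFormSolution_limit θ
    have := (M.isCompactResolvent_fibre hRε).abs_sub_le hevε (M.isCompactResolvent_limit hR) hev
      (hest ε hε θ Rε Γε R Γ hRε hR) hW ht (hε' ε θ Rε Γε hRε) (h' θ R Γ hR)
    rwa [mul_div_right_comm] at this
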